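/- Let $k$ be a field of arbitrary characteristic. A composition algebra $(A,*,n)$ is a $k$-vector space with a bilinear product $*$ and a quadratic form $n$ satisfying $n(x*y)=n(x)n(y)$ whose polar form $n(x,y)=n(x+y)-n(x)-n(y)$ is nondegenerate. It is a para-Hurwitz algebra if it is isomorphic, together with its norm, to $(C,\bullet,n)$ for a nonzero unital composition algebra $(C,\cdot,n)$, where $x\bullet y=\bar x\cdot\bar y$ and $\bar x=n(x,1)1-x$. The split Cayley algebra $C(k)$ has a basis $e_1,e_2,u_1,u_2,u_3,v_1,v_2,v_3$ in which $e_1,e_2$ are orthogonal idempotents with $e_1+e_2=1$, $e_1u_i=u_i=u_ie_2$, $e_2v_i=v_i=v_ie_1$, $u_iv_i=-e_1$, $v_iu_i=-e_2$, $u_iu_{i+1}=-u_{i+1}u_i=v_{i+2}$, $v_iv_{i+1}=-v_{i+1}v_i=u_{i+2}$ (indices modulo $3$), the remaining products being $0$; its norm is given by $n(e_1,e_2)=n(u_i,v_i)=1$, the basis elements being isotropic and all other pairs of them orthogonal. Let $\tau$ be the automorphism $e_i\mapsto e_i$, $u_i\mapsto u_{i+1}$, $v_i\mapsto v_{i+1}$.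 The pseudo-octonion algebra $P_8(k)$ is $C(k)$ with the same norm and the product $x*y=\tau(\bar x)\cdot\tau^2(\bar y)$. An Okubo algebra over $k$ is a form $(S,*,n)$ of $P_8(k)$: it becomes isomorphic to $P_8(K)$ over some field extension $K/k$. For nonzero $\alpha,\beta\in k$, $\mathcal O_{\alpha,\beta}$ is the Okubo algebra with basis $x_{i,j}$, $-1\le i,j\le 1$, $(i,j)\neq(0,0)$, and products $x_{i,j}*x_{k,l}=c\,x_{i+k,j+l}$ (subscripts modulo $3$), where the coefficient $c$ is given by the table (row $x_{i,j}$, column $x_{k,l}$) $$\begin{array}{c|cccccccc} & x_{1,0}&x_{-1,0}&x_{0,1}&x_{0,-1}&x_{1,1}&x_{-1,-1}&x_{-1,1}&x_{1,-1}\\ \hline x_{1,0}&-\alpha&0&0&1&0&1&0&\alpha\\ x_{-1,0}&0&-\alpha^{-1}&1&0&1&0&\alpha^{-1}&0\\ x_{0,1}&1&0&-\beta&0&\beta&0&0&1\\ x_{0,-1}&0&1&0&-\beta^{-1}&0&\beta^{-1}&1&0\\ x_{1,1}&\alpha&0&0&1&-\alpha\beta&0&\beta&0\\ x_{-1,-1}&0&\alpha^{-1}&1&0&0&-(\alpha\beta)^{-1}&0&\beta^{-1}\\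 x_{-1,1}&1&0&\beta&0&0&\alpha^{-1}&-\alpha^{-1}\beta&0\\ x_{1,-1}&0&1&0&\beta^{-1}&\alpha&0&0&-\alpha\beta^{-1} \end{array}$$ (its norm, determined by the product through $(x*y)*x=n(x)y$, satisfies $n(x_{i,j},x_{-i,-j})=1$, the basis elements being isotropic and all other pairs of them orthogonal). Its standard $\mathbb Z_3^2$-grading gives $x_{i,j}$ the degree $(\bar\imath,\bar\jmath)$; its standard $\mathbb Z_3$-grading gives $x_{i,j}$ the degree $\bar\jmath$. **Theorem.** Let $(S,*,n)$ be an Okubo algebra over $k$ and let $S=\bigoplus_{g\in G}S_g$ be a group grading: $G$ is a group (written additively, not assumed to be commutative), $S_g*S_h\subseteq S_{g+h}$ for all $g,h\in G$, and $G$ is generated by $\{g\in G: S_g\neq 0\}$. Assume that the grading is nontrivial, that is, $S\neq S_0$. Then exactly one of the following holds. 1. $S_0\neq 0$ and $S_0$, with the restriction of $n$, is a para-Hurwitz subalgebra of $S$. 2. $S_0$ is a two-dimensional subalgebra without nonzero idempotents, and there are a group isomorphism $\psi:G\to\mathbb Z_3$, nonzero scalars $\alpha,\beta\in k$ and a norm-preserving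 algebra isomorphism $\varphi:S\to\mathcal O_{\alpha,\beta}$ such that, for every $g\in G$, $\varphi(S_g)$ is the component of degree $\psi(g)$ of the standard $\mathbb Z_3$-grading of $\mathcal O_{\alpha,\beta}$; in particular $\varphi(S_0)=\operatorname{span}\{x_{1,0},x_{-1,0}\}$ is the subalgebra generated by $x_{1,0}$. 3. $S_0=0$, and there are a group isomorphism $\psi:G\to\mathbb Z_3^2$, nonzero scalars $\alpha,\beta\in k$ and a norm-preserving algebra isomorphism $\varphi:S\to\mathcal O_{\alpha,\beta}$ such that, for every $g\in G$, $\varphi(S_g)$ is the component of degree $\psi(g)$ of the standard $\mathbb Z_3^2$-grading of $\mathcal O_{\alpha,\beta}$. -/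

import Mathlib

open scoped TensorProduct

universe u v w

noncomputable section

namespace OkuboGradings

/-! ### Composition algebras -/

/-- `(A, *, n)` is a composition algebra: `n` is multiplicative and its polar form
`n(x, y) = n(x + y) - n(x) - n(y)` is nondegenerate. -/
structure IsComposition {k : Type u} [Field k] {A : Type v} [NonUnitalNonAssocRing A] [Module k A]
    (n : QuadraticForm k A) : Prop where
  norm_mul : ∀ x y : A, n (x * y) = n x * n y
  nondegenerate : ∀ x : A, (∀ y : A, QuadraticMap.polar n x y = 0) → x = 0

/-- The standard conjugation `x ↦ n(x, 1) 1 - x` of a unital algebra with norm `n`. -/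
def conj {k : Type u} [Field k] {C : Type v} [NonAssocRing C] [Module k C]
    (n : QuadraticForm k C) (x : C) : C :=
  QuadraticMap.polar n x 1 • (1 : C) - x

/-- The Petersson product `x * y = τ(x̄) · τ²(ȳ)` of a unital algebra `C` with norm `n` and a
self-map `τ`. -/
def petersson {k : Type u} [Field k] {C : Type v} [NonAssocRing C] [Module k C]
    (n : QuadraticForm k C) (τ : C → C) (x y : C) : C :=
  τ (conj n x) * τ (τ (conj n y))

/-- `(A, *, n)` is a para-Hurwitz algebra: it is isomorphic to the vector space of a Hurwitz
algebra (nonzero unital composition algebra) `(C, ·, N)` with its norm `N` and the product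
`x • y = x̄ · ȳ`. -/
def IsParaHurwitz {k : Type u} [Field k] {A : Type v} [NonUnitalNonAssocRing A] [Module k A]
    (n : QuadraticForm k A) : Prop :=
  ∃ (C : Type v) (_ : NonAssocRing C) (_ : Nontrivial C) (_ : Module k C)
    (_ : IsScalarTower k C C) (_ : SMulCommClass k C C) (N : QuadraticForm k C),
    IsComposition N ∧
    ∃ φ : A ≃ₗ[k] C, (∀ x, N (φ x) = n x) ∧ ∀ x y, φ (x * y) = conj N (φ x) * conj N (φ y)

/-! ### The split Cayley algebra -/

/-- The split Cayley algebra `C(k)`. The element `(a, b, u, v)` stands for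
`a e₁ + b e₂ + ∑ (u i) uᵢ + ∑ (v i) vᵢ` in a canonical basis `e₁, e₂, u₁, u₂, u₃, v₁, v₂, v₃`. -/
def SplitCayley (k : Type u) : Type u := k × k × (Fin 3 → k) × (Fin 3 → k)

namespace SplitCayley

variable {k : Type u} [Field k]

instance : AddCommGroup (SplitCayley k) :=
  inferInstanceAs (AddCommGroup (k × k × (Fin 3 → k) × (Fin 3 → k)))

instance : Module k (SplitCayley k) :=
  inferInstanceAs (Module k (k × k × (Fin 3 → k) × (Fin 3 → k)))

/-- The coordinates of an element in the canonical basis. -/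
def a : SplitCayley k →ₗ[k] k := LinearMap.fst k _ _
def b : SplitCayley k →ₗ[k] k := LinearMap.fst k _ _ ∘ₗ LinearMap.snd k k _
def u : SplitCayley k →ₗ[k] (Fin 3 → k) :=
  LinearMap.fst k _ _ ∘ₗ LinearMap.snd k k _ ∘ₗ LinearMap.snd k k _
def v : SplitCayley k →ₗ[k] (Fin 3 → k) :=
  LinearMap.snd k _ _ ∘ₗ LinearMap.snd k k _ ∘ₗ LinearMap.snd k k _

/-- The element with given coordinates. -/
def mk (a b : k) (u v : Fin 3 → k) : SplitCayley k := (a, b, u, v)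

@[simp] lemma a_mk (p q : k) (r s : Fin 3 → k) : (mk p q r s).a = p := rfl
@[simp] lemma b_mk (p q : k) (r s : Fin 3 → k) : (mk p q r s).b = q := rfl
@[simp] lemma u_mk (p q : k) (r s : Fin 3 → k) : (mk p q r s).u = r := rfl
@[simp] lemma v_mk (p q : k) (r s : Fin 3 → k) : (mk p q r s).v = s := rfl

lemma ext {x y : SplitCayley k} (ha : x.a = y.a) (hb : x.b = y.b) (hu : x.u = y.u)
    (hv : x.v = y.v) : x = y :=
  Prod.ext ha (Prod.ext hb (Prod.ext hu hv))

/-- The product: `eᵢ` are orthogonal idempotents with `e₁ + e₂ = 1`, `e₁ uᵢ = uᵢ = uᵢ e₂`,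
`e₂ vᵢ = vᵢ = vᵢ e₁`, `uᵢ vᵢ = -e₁`, `vᵢ uᵢ = -e₂`, `uᵢ uᵢ₊₁ = vᵢ₊₂ = -uᵢ₊₁ uᵢ`,
`vᵢ vᵢ₊₁ = uᵢ₊₂ = -vᵢ₊₁ vᵢ` (indices modulo `3`), all other products of basis elements are `0`. -/
instance : Mul (SplitCayley k) where
  mul x y := mk
    (x.a * y.a - x.u ⬝ᵥ y.v)
    (x.b * y.b - x.v ⬝ᵥ y.u)
    (x.a • y.u + y.b • x.u + crossProduct x.v y.v)
    (x.b • y.v + y.a • x.v + crossProduct x.u y.u)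

instance : One (SplitCayley k) where
  one := mk 1 1 0 0

lemma mul_def (x y : SplitCayley k) : x * y = mk
    (x.a * y.a - x.u ⬝ᵥ y.v)
    (x.b * y.b - x.v ⬝ᵥ y.u)
    (x.a • y.u + y.b • x.u + crossProduct x.v y.v)
    (x.b • y.v + y.a • x.v + crossProduct x.u y.u) := rfl

lemma one_def : (1 : SplitCayley k) = mk 1 1 0 0 := rfl

instance : NonAssocRing (SplitCayley k) where
  left_distrib x y z := by
    apply ext <;> simp [mul_def, mul_add, add_smul] <;> ring
  right_distrib x y z := by
    apply ext <;> simp [mul_def, add_mul, add_smul] <;> ring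
  zero_mul x := by apply ext <;> simp [mul_def]
  mul_zero x := by apply ext <;> simp [mul_def]
  one_mul x := by apply ext <;> simp [mul_def, one_def]
  mul_one x := by apply ext <;> simp [mul_def, one_def]

/-- The norm, with `n(e₁, e₂) = 1 = n(uᵢ, vᵢ)` and all other pairs of basis elements
orthogonal, all basis elements being isotropic. -/
def norm : QuadraticForm k (SplitCayley k) :=
  QuadraticMap.linMulLin a b +
    ∑ i, QuadraticMap.linMulLin (LinearMap.proj i ∘ₗ u) (LinearMap.proj i ∘ₗ v)

/-- The order `3` automorphism `τ_st`: `eᵢ ↦ eᵢ`, `uᵢ ↦ uᵢ₊₁`, `vᵢ ↦ vᵢ₊₁` (indices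
modulo `3`). -/
def tauSt (x : SplitCayley k) : SplitCayley k :=
  mk x.a x.b (fun i => x.u (i - 1)) (fun i => x.v (i - 1))

end SplitCayley

/-! ### Okubo algebras -/

/-- `(S, *, n)` is an Okubo algebra: a form of the pseudo-octonion algebra `P₈(k)`, that is, of
the space `C(k)` with its norm and the Petersson product for `τ_st`. So over some field extension
`K` of `k` there is an isomorphism of algebras from `K ⊗ S` onto `P₈(K) = K ⊗ P₈(k)` which
preserves the norm. The extension of `n` to `K ⊗ S` is determined by its values at the elements
`1 ⊗ x`, so the last condition is imposed on these. -/
def IsOkubo {k : Type u} [Field k] {S : Type v} [NonUnitalNonAssocRing S] [Module k S]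
    [IsScalarTower k S S] [SMulCommClass k S S] (n : QuadraticForm k S) : Prop :=
  ∃ (K : Type u) (_ : Field K) (_ : Algebra k K) (φ : (K ⊗[k] S) ≃ₗ[K] SplitCayley K),
    (∀ x y : K ⊗[k] S, φ (x * y) =
      petersson SplitCayley.norm SplitCayley.tauSt (φ x) (φ y)) ∧
    ∀ x : S, SplitCayley.norm (φ ((1 : K) ⊗ₜ[k] x)) = algebraMap k K (n x)

/-- The algebra `O_{α,β}`, through coordinates in its basis
`x_{1,0}, x_{-1,0}, x_{0,1}, x_{0,-1}, x_{1,1}, x_{-1,-1}, x_{-1,1}, x_{1,-1}` (in this order). -/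
def OkuboAlgebra {k : Type u} (_α _β : k) : Type u := Fin 8 → k

namespace OkuboAlgebra

/-- The subscript `(i, j)` modulo `3` of each of the basis elements `x_{i,j}`. -/
def idx : Fin 8 → ZMod 3 × ZMod 3 :=
  ![(1, 0), (-1, 0), (0, 1), (0, -1), (1, 1), (-1, -1), (-1, 1), (1, -1)]

/-- The coefficients in the multiplication table: the product of the `r`-th and the `s`-th
basis element is `table r s` times the basis element with subscript `idx r + idx s`. -/
def table {k : Type u} [Field k] (α β : k) : Matrix (Fin 8) (Fin 8) k :=
  !![-α,   0,    0,    1,    0,        1,           0,          α;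
      0,  -α⁻¹,  1,    0,    1,        0,           α⁻¹,        0;
      1,   0,   -β,    0,    β,        0,           0,          1;
      0,   1,    0,   -β⁻¹,  0,        β⁻¹,         1,          0;
      α,   0,    0,    1,   -(α * β),  0,           β,          0;
      0,   α⁻¹,  1,    0,    0,       -(α * β)⁻¹,   0,          β⁻¹;
      1,   0,    β,    0,    0,        α⁻¹,        -(α⁻¹ * β),  0;
      0,   1,    0,    β⁻¹,  α,        0,           0,         -(α * β⁻¹)]

variable {k : Type u} [Field k] {α β : k}

instance : AddCommGroup (OkuboAlgebra α β) := inferInstanceAs (AddCommGroup (Fin 8 → k))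

instance : Module k (OkuboAlgebra α β) := inferInstanceAs (Module k (Fin 8 → k))

/-- The coordinate of `f` at the `r`-th basis element. -/
def coord (r : Fin 8) : OkuboAlgebra α β →ₗ[k] k := LinearMap.proj (φ := fun _ : Fin 8 => k) r

/-- The basis elements `x_{i,j}`. -/
def x (α β : k) (r : Fin 8) : OkuboAlgebra α β := (Pi.single r 1 : Fin 8 → k)

lemma ext {f g : OkuboAlgebra α β} (h : ∀ r, coord r f = coord r g) : f = g := funext h

instance : Mul (OkuboAlgebra α β) where
  mul f g := (fun t => ∑ r, ∑ s,
    if idx r + idx s = idx t then coord r f * coord s g * table α β r s else 0 : Fin 8 → k)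

lemma coord_mul (f g : OkuboAlgebra α β) (t : Fin 8) : coord t (f * g) = ∑ r, ∑ s,
    if idx r + idx s = idx t then coord r f * coord s g * table α β r s else 0 := rfl

instance : NonUnitalNonAssocRing (OkuboAlgebra α β) where
  left_distrib f g h := by
    refine ext fun t => ?_
    simp only [map_add, coord_mul, ← Finset.sum_add_distrib]
    refine Finset.sum_congr rfl fun r _ => Finset.sum_congr rfl fun s _ => ?_
    split_ifs <;> ring
  right_distrib f g h := by
    refine ext fun t => ?_
    simp only [map_add, coord_mul, ← Finset.sum_add_distrib]
    refine Finset.sum_congr rfl fun r _ => Finset.sum_congr rfl fun s _ => ?_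
    split_ifs <;> ring
  zero_mul f := ext fun t => by simp [coord_mul]
  mul_zero f := ext fun t => by simp [coord_mul]

instance : IsScalarTower k (OkuboAlgebra α β) (OkuboAlgebra α β) where
  smul_assoc c f g := ext fun t => by
    simp only [smul_eq_mul, map_smul, coord_mul, Finset.mul_sum]
    refine Finset.sum_congr rfl fun r _ => Finset.sum_congr rfl fun s _ => ?_
    split_ifs <;> ring

instance : SMulCommClass k (OkuboAlgebra α β) (OkuboAlgebra α β) where
  smul_comm c f g := ext fun t => by
    simp only [smul_eq_mul, map_smul, coord_mul, Finset.mul_sum]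
    refine Finset.sum_congr rfl fun r _ => Finset.sum_congr rfl fun s _ => ?_
    split_ifs <;> ring

/-- The norm of `O_{α,β}`, with `n(x_{i,j}, x_{-i,-j}) = 1` and all other pairs of basis elements
orthogonal, all basis elements being isotropic. It is the only map with
`(f * g) * f = n(f) g = f * (g * f)`. -/
def norm : QuadraticForm k (OkuboAlgebra α β) :=
  QuadraticMap.linMulLin (coord 0) (coord 1) + QuadraticMap.linMulLin (coord 2) (coord 3) +
    QuadraticMap.linMulLin (coord 4) (coord 5) + QuadraticMap.linMulLin (coord 6) (coord 7)

/-- The standard `ℤ₃²`-grading of `O_{α,β}`: `x_{i,j}` has degree `(i, j)` modulo `3`. -/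
def standardGrading₂ (α β : k) (g : ZMod 3 × ZMod 3) : Submodule k (OkuboAlgebra α β) :=
  Submodule.span k {f | ∃ r, idx r = g ∧ f = x α β r}

/-- The standard `ℤ₃`-grading of `O_{α,β}`: the component of degree `i` is the sum of the
components of degree `(j, i)` of the standard `ℤ₃²`-grading. -/
def standardGrading₁ (α β : k) (i : ZMod 3) : Submodule k (OkuboAlgebra α β) :=
  ⨆ j : ZMod 3, standardGrading₂ α β (j, i)

end OkuboAlgebra

/-- `φ` is an isomorphism of algebras with norm from `(S, *, n)` onto `O_{α,β}`. -/
structure IsOkuboIso {k : Type u} [Field k] {S : Type v} [NonUnitalNonAssocRing S] [Module k S]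
    (n : QuadraticForm k S) {α β : k} (φ : S ≃ₗ[k] OkuboAlgebra α β) : Prop where
  map_mul : ∀ x y, φ (x * y) = φ x * φ y
  map_norm : ∀ x, OkuboAlgebra.norm (φ x) = n x

/-! ### Gradings -/

/-- `S = ⨁ S_g` is a group grading: `S` is the direct sum of the subspaces `S_g`,
`S_g * S_h ⊆ S_{g+h}`, and the group `G` (written additively, but not assumed to be commutative)
is generated by the elements `g` with `S_g ≠ 0`. -/
structure IsGroupGrading {k : Type u} [Field k] {S : Type v} [NonUnitalNonAssocRing S]
    [Module k S] {G : Type w} [AddGroup G] [DecidableEq G] (𝒮 : G → Submodule k S) : Prop where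
  isInternal : DirectSum.IsInternal 𝒮
  mul_mem : ∀ ⦃g h : G⦄ ⦃x y : S⦄, x ∈ 𝒮 g → y ∈ 𝒮 h → x * y ∈ 𝒮 (g + h)
  closure_support : AddSubgroup.closure {g : G | 𝒮 g ≠ ⊥} = ⊤

/-- The component `S_0` of a group grading, as a subalgebra. -/
def IsGroupGrading.zero {k : Type u} [Field k] {S : Type v} [NonUnitalNonAssocRing S]
    [Module k S] {G : Type w} [AddGroup G] [DecidableEq G] {𝒮 : G → Submodule k S}
    (h : IsGroupGrading 𝒮) : NonUnitalSubalgebra k S where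
  __ := 𝒮 0
  mul_mem' hx hy := by simpa using h.mul_mem hx hy

/-- Case 1: `S_0` is a nonzero para-Hurwitz subalgebra (with the restriction of the norm). -/
def ParaHurwitzCase {k : Type u} [Field k] {S : Type v} [NonUnitalNonAssocRing S]
    [Module k S] {G : Type w} [AddGroup G] [DecidableEq G] {𝒮 : G → Submodule k S}
    (n : QuadraticForm k S) (h : IsGroupGrading 𝒮) : Prop :=
  𝒮 0 ≠ ⊥ ∧ IsParaHurwitz (A := h.zero)
    (n.comp (NonUnitalSubalgebraClass.subtype h.zero : h.zero →ₗ[k] S))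

/-- Case 2: `S_0` is a two-dimensional subalgebra without nonzero idempotents, `G ≅ ℤ₃`, and up to
isomorphism the grading is the standard `ℤ₃`-grading of some `O_{α,β}`, `S_0` being mapped onto
the subalgebra generated by `x_{1,0}`. -/
def StandardZ3Case {k : Type u} [Field k] {S : Type v} [NonUnitalNonAssocRing S]
    [Module k S] {G : Type w} [AddGroup G] [DecidableEq G] {𝒮 : G → Submodule k S}
    (n : QuadraticForm k S) (h : IsGroupGrading 𝒮) : Prop :=
  Module.finrank k h.zero = 2 ∧ (∀ e ∈ h.zero, e * e = e → e = 0) ∧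
    ∃ (ψ : G ≃+ ZMod 3) (α β : k) (φ : S ≃ₗ[k] OkuboAlgebra α β),
      α ≠ 0 ∧ β ≠ 0 ∧ IsOkuboIso n φ ∧
      (∀ g, (𝒮 g).map (φ : S →ₗ[k] OkuboAlgebra α β) =
        OkuboAlgebra.standardGrading₁ α β (ψ g)) ∧
      (𝒮 0).map (φ : S →ₗ[k] OkuboAlgebra α β) =
        (NonUnitalAlgebra.adjoin k {OkuboAlgebra.x α β 0}).toSubmodule

/-- Case 3: `S_0 = 0`, `G ≅ ℤ₃²`, and up to isomorphism the grading is the standard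
`ℤ₃²`-grading of some `O_{α,β}`. -/
def StandardZ3SquaredCase {k : Type u} [Field k] {S : Type v} [NonUnitalNonAssocRing S]
    [Module k S] {G : Type w} [AddGroup G] [DecidableEq G] {𝒮 : G → Submodule k S}
    (n : QuadraticForm k S) (_h : IsGroupGrading 𝒮) : Prop :=
  𝒮 0 = ⊥ ∧
    ∃ (ψ : G ≃+ ZMod 3 × ZMod 3) (α β : k) (φ : S ≃ₗ[k] OkuboAlgebra α β),
      α ≠ 0 ∧ β ≠ 0 ∧ IsOkuboIso n φ ∧
      ∀ g, (𝒮 g).map (φ : S →ₗ[k] OkuboAlgebra α β) =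
        OkuboAlgebra.standardGrading₂ α β (ψ g)

end OkuboGradings

end

open OkuboGradings

/-!
The argument rests on the identities `(x * y) * x = n(x) y = x * (y * x)` together with the
multiplicativity of the norm and the associativity of its polar form, which say that an Okubo
algebra is a symmetric composition algebra. They hold in the pseudo-octonion algebra by a
computation in coordinates and descend along the extension of scalars (`IsOkubo.isSymmComp`);
nothing else about Okubo algebras is used except that their dimension is eight. The linearized
identity `(x * y) * z + (z * y) * x = n(x, z) y` shows that components are orthogonal unless their
degrees are opposite and that the degrees in the support commute. So `S_0` is a subalgebra on which
the norm is nondegenerate, and there are three possibilities.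

If `S_0` contains a nonzero idempotent `e` that commutes with `S_0`, the product
`(e * x) * (y * e)` is that of a Hurwitz algebra with unit `e` and conjugation `x ↦ e * x`, so `S_0`
is para-Hurwitz (`IsParaUnit.isParaHurwitz`). If `S_0 ≠ 0` this fails only for a commutative plane
(`IsSymmComp.exists_central_idempotent_or_plane`): a plane `P` spanned by `x` and `x * x` is
nondegenerate for a suitable `x`, and if `u ∈ S_0` is orthogonal to `P` with `n(u) ≠ 0`, then
`n(u, u * u) = 0`, so that `-n(u)⁻¹ (u * u)` is an idempotent; it commutes with
`P ⊕ P * u`, which is all of `S_0` since a proper nondegenerate subalgebra has dimension at most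
four.

If `S_0` is a plane without nonzero idempotents, all vectors of nonzero degree are isotropic,
which forces `S_0` to contain an isotropic vector `x`, and `α = -n(x, x * x)` is not a cube. On a
component of nonzero degree the multiplications by `x` and `x * x` annihilate each other, and on
the kernel of one of them the cube of the other is a scalar that is not a cube. Hence there are two
other components, both of dimension three, and `x` (or a multiple of `x * x` in its place) annihilates a
vector `u` of nonzero degree, for which `n(u, u * u) ≠ 0`.

If `S_0 = 0`, every component is a line on which the cubic form `n(x, x * x)` is anisotropic, and
homogeneous elements of independent degrees multiply to zero in exactly one order.

In the last two cases there are homogeneous isotropic orthogonal elements `a`, `b` with `a * b = 0`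
and `n(a, a * a)`, `n(b, b * b)` nonzero. Such elements generate a copy of `O_{α,β}`
(`IsOkuboFrame.exists_isOkuboIso`), with a basis of homogeneous elements, and the degrees of these
determine the grading.
-/

open QuadraticMap (polar)

set_option linter.unusedSectionVars false

namespace OkuboGradings

/-! ### The identities of the pseudo-octonion algebra -/

section Pseudooctonion

variable {K : Type u} [Field K]

namespace SplitCayley

lemma norm_apply (x : SplitCayley K) :
    norm x = x.a * x.b + (x.u 0 * x.v 0 + x.u 1 * x.v 1 + x.u 2 * x.v 2) := by
  simp [norm, Fin.sum_univ_three]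

lemma polar_norm (x y : SplitCayley K) :
    polar norm x y = x.a * y.b + x.b * y.a +
      (x.u 0 * y.v 0 + x.u 1 * y.v 1 + x.u 2 * y.v 2) +
      (x.v 0 * y.u 0 + x.v 1 * y.u 1 + x.v 2 * y.u 2) := by
  simp only [polar, norm_apply, map_add, Pi.add_apply]
  ring

lemma conj_norm (x : SplitCayley K) : conj norm x = mk x.b x.a (-x.u) (-x.v) := by
  have h : polar norm x 1 = x.a + x.b := by simp [polar_norm, one_def]
  unfold conj
  rw [h]
  apply ext <;> simp [one_def]

/-- The pseudo-octonion product in coordinates. -/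
lemma petersson_eq (x y : SplitCayley K) : petersson norm tauSt x y = mk
    (x.b * y.b - (x.u 0 * y.v 2 + x.u 1 * y.v 0 + x.u 2 * y.v 1))
    (x.a * y.a - (x.v 0 * y.u 2 + x.v 1 * y.u 0 + x.v 2 * y.u 1))
    ![-(x.b * y.u 1) - x.u 2 * y.a + (x.v 0 * y.v 0 - x.v 1 * y.v 2),
      -(x.b * y.u 2) - x.u 0 * y.a + (x.v 1 * y.v 1 - x.v 2 * y.v 0),
      -(x.b * y.u 0) - x.u 1 * y.a + (x.v 2 * y.v 2 - x.v 0 * y.v 1)]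
    ![-(x.a * y.v 1) - x.v 2 * y.b + (x.u 0 * y.u 0 - x.u 1 * y.u 2),
      -(x.a * y.v 2) - x.v 0 * y.b + (x.u 1 * y.u 1 - x.u 2 * y.u 0),
      -(x.a * y.v 0) - x.v 1 * y.b + (x.u 2 * y.u 2 - x.u 0 * y.u 1)] := by
  have e0 : (0 : Fin 3) - 1 = 2 := rfl
  have e2 : (2 : Fin 3) - 1 = 1 := rfl
  apply ext
  · simp [petersson, conj_norm, tauSt, mul_def, dotProduct, Fin.sum_univ_three, e0, e2]
    ring
  · simp [petersson, conj_norm, tauSt, mul_def, dotProduct, Fin.sum_univ_three, e0, e2]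
    ring
  · funext i
    fin_cases i <;>
      simp [petersson, conj_norm, tauSt, mul_def, crossProduct, Matrix.vecHead,
        Matrix.vecTail, e0, e2] <;> ring
  · funext i
    fin_cases i <;>
      simp [petersson, conj_norm, tauSt, mul_def, crossProduct, Matrix.vecHead,
        Matrix.vecTail, e0, e2] <;> ring

lemma petersson_flexible_left (x y : SplitCayley K) :
    petersson norm tauSt (petersson norm tauSt x y) x = norm x • y := by
  apply ext
  · simp [petersson_eq, norm_apply]; ring
  · simp [petersson_eq, norm_apply]; ring
  · funext i
    fin_cases i <;> simp [petersson_eq, norm_apply] <;> ring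
  · funext i
    fin_cases i <;> simp [petersson_eq, norm_apply] <;> ring

lemma petersson_flexible_right (x y : SplitCayley K) :
    petersson norm tauSt x (petersson norm tauSt y x) = norm x • y := by
  apply ext
  · simp [petersson_eq, norm_apply]; ring
  · simp [petersson_eq, norm_apply]; ring
  · funext i
    fin_cases i <;> simp [petersson_eq, norm_apply] <;> ring
  · funext i
    fin_cases i <;> simp [petersson_eq, norm_apply] <;> ring

lemma norm_petersson (x y : SplitCayley K) :
    norm (petersson norm tauSt x y) = norm x * norm y := by
  simp [petersson_eq, norm_apply]; ring

lemma polar_petersson (x y z : SplitCayley K) :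
    polar norm (petersson norm tauSt x y) z = polar norm x (petersson norm tauSt y z) := by
  simp [petersson_eq, polar_norm]; ring

lemma eq_zero_of_polar_norm {x : SplitCayley K} (h : ∀ y, polar norm x y = 0) : x = 0 := by
  have hs : ∀ (i j : Fin 3), (Pi.single i (1 : K) : Fin 3 → K) j = if j = i then 1 else 0 :=
    fun i j => by simp [Pi.single_apply]
  apply ext
  · simpa [polar_norm] using h (mk 0 1 0 0)
  · simpa [polar_norm] using h (mk 1 0 0 0)
  · funext i
    have := h (mk 0 0 0 (Pi.single i 1))
    fin_cases i <;> simpa [polar_norm, hs] using this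
  · funext i
    have := h (mk 0 0 (Pi.single i 1) 0)
    fin_cases i <;> simpa [polar_norm, hs] using this

lemma finrank_eq : Module.finrank K (SplitCayley K) = 8 := by
  change Module.finrank K (K × K × (Fin 3 → K) × (Fin 3 → K)) = 8
  simp

end SplitCayley

end Pseudooctonion

/-! ### Symmetric composition algebras -/

/-- `(S, *, n)` is a symmetric composition algebra: besides the axioms of a composition algebra,
`(x * y) * x = n(x) y = x * (y * x)` and the polar form of `n` is associative. (Some of these
conditions imply the others.) -/
structure IsSymmComp {k : Type u} [Field k] {S : Type v} [NonUnitalNonAssocRing S] [Module k S]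
    (n : QuadraticForm k S) : Prop where
  mul_mul_left : ∀ x y : S, (x * y) * x = n x • y
  mul_mul_right : ∀ x y : S, x * (y * x) = n x • y
  norm_mul : ∀ x y : S, n (x * y) = n x * n y
  polar_mul : ∀ x y z : S, polar n (x * y) z = polar n x (y * z)
  nondegenerate : ∀ x : S, (∀ y : S, polar n x y = 0) → x = 0

variable {k : Type u} [Field k] {S : Type v} [NonUnitalNonAssocRing S] [Module k S]
  {n : QuadraticForm k S}

section FromOkubo

variable [IsScalarTower k S S] [SMulCommClass k S S]

/-- The identities of the pseudo-octonion algebra descend along the extension of scalars. -/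
theorem IsOkubo.isSymmComp (hS : IsOkubo n) : IsSymmComp n := by
  obtain ⟨K, _, _, φ, hmul, hnorm⟩ := hS
  let j : S → SplitCayley K := fun x => φ ((1 : K) ⊗ₜ[k] x)
  have jinj : Function.Injective j :=
    φ.injective.comp (Module.FaithfullyFlat.tensorProduct_mk_injective (A := k) (B := K) S)
  have jmul : ∀ x y, j (x * y) = petersson SplitCayley.norm SplitCayley.tauSt (j x) (j y) := by
    intro x y
    have := hmul ((1 : K) ⊗ₜ[k] x) ((1 : K) ⊗ₜ[k] y)
    simpa using this
  have jsmul : ∀ (c : k) x, j (c • x) = algebraMap k K c • j x := by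
    intro c x
    have : (1 : K) ⊗ₜ[k] (c • x) = algebraMap k K c • ((1 : K) ⊗ₜ[k] x) := by
      rw [TensorProduct.tmul_smul, algebraMap_smul]
    simp only [j, this, map_smul]
  have jadd : ∀ x y, j (x + y) = j x + j y := by
    intro x y
    simp only [j, TensorProduct.tmul_add, map_add]
  have jpolar : ∀ x y, polar SplitCayley.norm (j x) (j y) = algebraMap k K (polar n x y) := by
    intro x y
    simp only [polar, ← jadd, map_sub]
    simp only [j, hnorm]
  have ainj : Function.Injective (algebraMap k K) := (algebraMap k K).injective
  refine ⟨fun x y => jinj ?_, fun x y => jinj ?_, fun x y => ainj ?_, fun x y z => ainj ?_,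
    fun x hx => jinj ?_⟩
  · rw [jmul, jmul, jsmul, SplitCayley.petersson_flexible_left, ← hnorm]
  · rw [jmul, jmul, jsmul, SplitCayley.petersson_flexible_right, ← hnorm]
  · rw [RingHom.map_mul, ← hnorm, ← hnorm, ← hnorm]
    have := jmul x y
    simp only [j] at this
    rw [this, SplitCayley.norm_petersson]
  · rw [← jpolar, ← jpolar, jmul, jmul, SplitCayley.polar_petersson]
  · have h0 : j 0 = 0 := by simp [j]
    rw [h0]
    refine SplitCayley.eq_zero_of_polar_norm fun y => ?_
    obtain ⟨t, rfl⟩ := φ.surjective y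
    induction t using TensorProduct.induction_on with
    | zero => simp
    | add s t hs ht => rw [map_add, QuadraticMap.polar_add_right, hs, ht, add_zero]
    | tmul c y =>
      have : c ⊗ₜ[k] y = c • ((1 : K) ⊗ₜ[k] y) := by
        rw [TensorProduct.smul_tmul', smul_eq_mul, mul_one]
      rw [this, map_smul, QuadraticMap.polar_smul_right]
      have := jpolar x y
      simp only [j] at this ⊢
      rw [this, hx, map_zero, smul_zero]

theorem IsOkubo.finrank_eq (hS : IsOkubo n) : Module.finrank k S = 8 := by
  obtain ⟨K, _, _, φ, -, -⟩ := hS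
  rw [← Module.finrank_baseChange (R := K), φ.finrank_eq, SplitCayley.finrank_eq]

end FromOkubo

lemma norm_smul (n : QuadraticForm k S) (c : k) (x : S) : n (c • x) = c ^ 2 * n x := by
  rw [QuadraticMap.map_smul, smul_eq_mul, pow_two]

lemma norm_add (n : QuadraticForm k S) (x y : S) : n (x + y) = n x + n y + polar n x y :=
  QuadraticMap.map_add n x y

lemma polar_self_eq (n : QuadraticForm k S) (x : S) : polar n x x = 2 * n x := by
  rw [QuadraticMap.polar_self, nsmul_eq_mul, Nat.cast_ofNat]

/-- A nonzero subspace with nondegenerate polar form contains a vector that is not isotropic, since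
the polar form vanishes where the quadratic form does. -/
lemma exists_norm_ne_zero {W : Submodule k S}
    (hnd : ∀ x ∈ W, (∀ y ∈ W, polar n x y = 0) → x = 0) (hW : W ≠ ⊥) : ∃ x ∈ W, n x ≠ 0 := by
  obtain ⟨x, hx, hx0⟩ := W.ne_bot_iff.1 hW
  by_contra! h
  refine hx0 (hnd x hx fun y hy => ?_)
  simp [polar, h _ hx, h _ hy, h _ (W.add_mem hx hy)]

namespace IsSymmComp

lemma mul_mul_add (hn : IsSymmComp n) (x y z : S) :
    (x * y) * z + (z * y) * x = polar n x z • y := by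
  have h := hn.mul_mul_left (x + z) y
  rw [norm_add, add_smul, add_smul, ← hn.mul_mul_left x y, ← hn.mul_mul_left z y] at h
  simp only [add_mul, mul_add] at h
  rw [← sub_eq_zero] at h ⊢
  rw [← h]
  abel

lemma mul_mul_add' (hn : IsSymmComp n) (x y z : S) :
    x * (y * z) + z * (y * x) = polar n x z • y := by
  have h := hn.mul_mul_right (x + z) y
  rw [norm_add, add_smul, add_smul, ← hn.mul_mul_right x y, ← hn.mul_mul_right z y] at h
  simp only [add_mul, mul_add] at h
  rw [← sub_eq_zero] at h ⊢
  rw [← h]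
  abel

lemma mul_mul_eq (hn : IsSymmComp n) (x y z : S) :
    (x * y) * z = polar n x z • y - (z * y) * x := by
  rw [← hn.mul_mul_add x y z, add_sub_cancel_right]

lemma mul_mul_eq' (hn : IsSymmComp n) (x y z : S) :
    x * (y * z) = polar n x z • y - z * (y * x) := by
  rw [← hn.mul_mul_add' x y z, add_sub_cancel_right]

lemma polar_mul_mul_right (hn : IsSymmComp n) (x y u : S) :
    polar n (x * u) (y * u) = n u * polar n x y := by
  rw [hn.polar_mul, hn.mul_mul_right, QuadraticMap.polar_smul_right, smul_eq_mul]

lemma eq_zero_of_mul_eq_zero (hn : IsSymmComp n) {x u : S} (hu : n u ≠ 0) (h : x * u = 0) :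
    x = 0 := by
  have := hn.mul_mul_right u x
  rw [h, mul_zero] at this
  exact (smul_eq_zero.1 this.symm).resolve_left hu

lemma norm_eq_one_of_isIdempotent (hn : IsSymmComp n) {e : S} (he : e * e = e) (he0 : e ≠ 0) :
    n e = 1 := by
  have h := hn.mul_mul_left e e
  rw [he, he] at h
  have : (n e - 1) • e = 0 := by rw [sub_smul, one_smul, ← h, sub_self]
  exact sub_eq_zero.1 ((smul_eq_zero.1 this).resolve_right he0)

variable [IsScalarTower k S S]

/-- The cubic form `x ↦ n(x, x * x)` governs the subalgebra generated by `x`. -/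
lemma sq_mul_sq (hn : IsSymmComp n) (x : S) :
    (x * x) * (x * x) = polar n x (x * x) • x - n x • (x * x) := by
  rw [hn.mul_mul_eq, hn.mul_mul_left, smul_mul_assoc]

variable [SMulCommClass k S S]

/-- A vector `u` that is not isotropic and satisfies `n(u, u * u) = 0` provides an idempotent. -/
lemma isIdempotent_of_polar_sq_eq_zero (hn : IsSymmComp n) {u : S} (hu : n u ≠ 0)
    (h : polar n u (u * u) = 0) :
    (-(n u)⁻¹ • (u * u)) * (-(n u)⁻¹ • (u * u)) = -(n u)⁻¹ • (u * u) ∧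
      -(n u)⁻¹ • (u * u) ≠ 0 := by
  constructor
  · rw [smul_mul_smul_comm, hn.sq_mul_sq, h, zero_smul, zero_sub, smul_neg, smul_smul, ← neg_smul]
    congr 1
    field_simp
  · refine smul_ne_zero (neg_ne_zero.2 (inv_ne_zero hu)) fun h0 => ?_
    have := hn.norm_mul u u
    rw [h0, QuadraticMap.map_zero] at this
    exact mul_ne_zero hu hu this.symm

/-- Along the plane spanned by `x` and `y` the cubic form `z ↦ n(z, z * z)` is a binary cubic. -/
lemma polar_sq_add (hn : IsSymmComp n) (s t : k) (x y : S) :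
    polar n (s • x + t • y) ((s • x + t • y) * (s • x + t • y)) =
      s ^ 3 * polar n x (x * x) + 3 * s ^ 2 * t * polar n (x * x) y +
        3 * s * t ^ 2 * polar n x (y * y) + t ^ 3 * polar n y (y * y) := by
  have h1 : polar n x (x * y) = polar n (x * x) y := (hn.polar_mul x x y).symm
  have h2 : polar n x (y * x) = polar n (x * x) y := by
    rw [← hn.polar_mul, QuadraticMap.polar_comm, ← hn.polar_mul]
  have h3 : polar n y (x * x) = polar n (x * x) y := QuadraticMap.polar_comm _ _ _
  have h4 : polar n y (x * y) = polar n x (y * y) := by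
    rw [← hn.polar_mul, QuadraticMap.polar_comm, ← hn.polar_mul, QuadraticMap.polar_comm]
  have h5 : polar n y (y * x) = polar n x (y * y) := by
    rw [← hn.polar_mul, QuadraticMap.polar_comm]
  simp only [add_mul, mul_add, smul_mul_assoc, mul_smul_comm, QuadraticMap.polar_add_left,
    QuadraticMap.polar_add_right, QuadraticMap.polar_smul_left, QuadraticMap.polar_smul_right,
    smul_eq_mul, h1, h2, h3, h4, h5]
  ring

lemma polar_sq_smul (n : QuadraticForm k S) (c : k) (x : S) :
    polar n (c • x) ((c • x) * (c • x)) = c ^ 3 * polar n x (x * x) := by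
  simp only [smul_mul_assoc, mul_smul_comm, QuadraticMap.polar_smul_left,
    QuadraticMap.polar_smul_right, smul_eq_mul]
  ring

/-- The elimination behind `exists_disc_ne_zero`: for orthogonal vectors with norm `1` and cubic
form `2`, the Gram determinants of the vectors `s x + t y` cannot all vanish. The points `(1, ±1)`,
`(1, ±2)`, `(2, ±1)` suffice to see this, in every characteristic other than two. -/
lemma disc_elimination (h2 : (2 : k) ≠ 0) (A B : k)
    (h : ∀ s t : k, 4 * (s ^ 2 + t ^ 2) ^ 3 =
      (2 * s ^ 3 + 3 * s ^ 2 * t * A + 3 * s * t ^ 2 * B + 2 * t ^ 3) ^ 2) : False := by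
  have two_pow : ∀ (m : ℕ) (z : k), 2 ^ m * z = 0 → z = 0 := fun m z hz =>
    (mul_eq_zero.1 hz).resolve_left (pow_ne_zero m h2)
  have key : ∀ A B : k, (∀ s t : k, 4 * (s ^ 2 + t ^ 2) ^ 3 =
      (2 * s ^ 3 + 3 * s ^ 2 * t * A + 3 * s * t ^ 2 * B + 2 * t ^ 3) ^ 2) →
      2 + 3 * B = 0 → False := by
    intro A B h hB
    have e1 : (1 + 2 * (3 * B)) * (8 + 3 * A) = 0 :=
      two_pow 4 _ (by linear_combination h 1 (-2) - h 1 2)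
    have e2 : (3 * B - 3 * A) ^ 2 = 32 := by linear_combination -h 1 (-1)
    rcases mul_eq_zero.1 e1 with e | e
    · have h3 : (3 : k) = 0 := by linear_combination 2 * hB - e
      exact h2 (by linear_combination hB - B * h3)
    · have : (2 : k) ^ 2 * 1 = 0 := by
        have hb : 3 * B = -2 := by linear_combination hB
        have ha : 3 * A = -8 := by linear_combination e
        rw [hb, ha] at e2
        linear_combination e2
      exact one_ne_zero (two_pow 2 _ this)
  have e0 : (2 + 3 * B) * (2 + 3 * A) = 0 := two_pow 2 _ (by linear_combination h 1 (-1) - h 1 1)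
  rcases mul_eq_zero.1 e0 with e | e
  · exact key A B h e
  · exact key B A (fun s t => by linear_combination h t s) e

/-- A nonzero subalgebra on which the norm is nondegenerate contains an element `x` for which the
subalgebra spanned by `x` and `x * x` is a nondegenerate plane, the Gram determinant
being `4 n(x)³ - n(x, x * x)²`, unless it contains a central idempotent for trivial reasons. -/
lemma exists_disc_ne_zero (hn : IsSymmComp n) {Q : Submodule k S}
    (hmul : ∀ x ∈ Q, ∀ y ∈ Q, x * y ∈ Q)
    (hnd : ∀ x ∈ Q, (∀ y ∈ Q, polar n x y = 0) → x = 0) (hQ : Q ≠ ⊥) :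
    (∃ x ∈ Q, 4 * n x ^ 3 - polar n x (x * x) ^ 2 ≠ 0) ∨
      ∃ e ∈ Q, e ≠ 0 ∧ e * e = e ∧ ∀ x ∈ Q, e * x = x * e := by
  obtain ⟨x, hx, hnx⟩ := exists_norm_ne_zero hnd hQ
  rw [or_iff_not_imp_left]
  intro hD
  push Not at hD
  have hD' : ∀ x ∈ Q, 4 * n x ^ 3 = polar n x (x * x) ^ 2 := fun x hx => sub_eq_zero.1 (hD x hx)
  by_cases h2 : (2 : k) = 0
  · -- In characteristic two the cubic form vanishes on `Q`; polarized, this says that squaring is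
    -- additive on `Q`, so that `Q` is commutative.
    have h4 : (4 : k) = 0 := by linear_combination 2 * h2
    have hg : ∀ x ∈ Q, polar n x (x * x) = 0 := fun x hx => by
      have := hD' x hx
      rw [h4, zero_mul] at this
      exact pow_eq_zero_iff two_ne_zero |>.1 this.symm
    have hsq : ∀ x ∈ Q, ∀ y ∈ Q, polar n (x * x) y = polar n x (y * y) := fun x hx y hy => by
      have := hn.polar_sq_add 1 1 x y
      rw [one_smul, one_smul, hg _ (Q.add_mem hx hy), hg x hx, hg y hy] at this
      linear_combination -this - (polar n (x * x) y + 2 * polar n x (y * y)) * h2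
    have hcomm : ∀ x ∈ Q, ∀ y ∈ Q, x * y = y * x := fun x hx y hy => by
      have : x * y + y * x = 0 := by
        refine hnd _ (Q.add_mem (hmul x hx y hy) (hmul y hy x hx)) fun z hz => ?_
        have := hsq (x + y) (Q.add_mem hx hy) z hz
        have hxz := hsq x hx z hz
        have hyz := hsq y hy z hz
        simp only [add_mul, mul_add, QuadraticMap.polar_add_left] at this ⊢
        linear_combination this - hxz - hyz
      have hneg : -(y * x) = y * x := by
        rw [neg_eq_iff_add_eq_zero, ← two_smul k, h2, zero_smul]
      rw [← hneg]
      exact eq_neg_of_add_eq_zero_left this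
    obtain ⟨h1, h0⟩ := hn.isIdempotent_of_polar_sq_eq_zero hnx (hg x hx)
    have he := Q.smul_mem (-(n x)⁻¹) (hmul x hx x hx)
    exact ⟨_, he, h0, h1, fun y hy => hcomm _ he y hy⟩
  · -- If the Gram determinant vanishes identically, then every vector that is not isotropic can be
    -- scaled so that `n(x) = 1` and `n(x, x * x) = 2`.
    have hscale : ∀ x ∈ Q, n x ≠ 0 → ∃ c : k, n (c • x) = 1 ∧
        polar n (c • x) ((c • x) * (c • x)) = 2 := by
      intro x hx hnx
      have h4 : (4 : k) ≠ 0 := by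
        have := mul_ne_zero h2 h2
        norm_num at this
        exact this
      have hd := hD' x hx
      have hg : polar n x (x * x) ≠ 0 := fun h0 => by
        rw [h0] at hd
        exact mul_ne_zero h4 (pow_ne_zero 3 hnx) (by simpa using hd)
      -- The square of `2 n(x) / n(x, x * x)` is `1 / n(x)` because `4 n(x)³ = n(x, x * x)²`.
      refine ⟨2 * n x / polar n x (x * x), ?_, ?_⟩
      · rw [norm_smul]
        field_simp
        linear_combination hd
      · rw [polar_sq_smul]
        field_simp
        linear_combination hd
    by_cases hy : ∃ y ∈ Q, polar n x y = 0 ∧ n y ≠ 0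
    · obtain ⟨y, hy, hxy, hny⟩ := hy
      obtain ⟨c, hc1, hc2⟩ := hscale x hx hnx
      obtain ⟨d, hd1, hd2⟩ := hscale y hy hny
      exfalso
      refine disc_elimination h2 (polar n ((c • x) * (c • x)) (d • y))
        (polar n (c • x) ((d • y) * (d • y))) fun s t => ?_
      have hm : s • c • x + t • d • y ∈ Q :=
        Q.add_mem (Q.smul_mem _ (Q.smul_mem _ hx)) (Q.smul_mem _ (Q.smul_mem _ hy))
      have := hD' _ hm
      rw [hn.polar_sq_add, norm_add, norm_smul n s, norm_smul n t, hc1, hc2, hd1, hd2] at this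
      simp only [QuadraticMap.polar_smul_left, QuadraticMap.polar_smul_right, hxy, smul_zero,
        add_zero] at this
      simp only [QuadraticMap.polar_smul_left, QuadraticMap.polar_smul_right, smul_mul_assoc,
        mul_smul_comm, smul_eq_mul] at this ⊢
      linear_combination this
    · -- Otherwise `Q` is the line through `x`.
      push Not at hy
      have hline : ∀ z ∈ Q, ∃ c : k, z = c • x := by
        have hproj : ∀ z, polar n x (z - (polar n x z / (2 * n x)) • x) = 0 := fun z => by
          rw [QuadraticMap.polar_sub_right, QuadraticMap.polar_smul_right, polar_self_eq,
            smul_eq_mul]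
          field_simp
          ring
        have hpm : ∀ z ∈ Q, z - (polar n x z / (2 * n x)) • x ∈ Q := fun z hz =>
          Q.sub_mem hz (Q.smul_mem _ hx)
        intro z hz
        refine ⟨polar n x z / (2 * n x), sub_eq_zero.1 (hnd _ (hpm z hz) fun w hw => ?_)⟩
        have h0 := hy _ (hpm z hz) (hproj z)
        have h1 := hy _ (hpm w hw) (hproj w)
        have h01 := hy _ (Q.add_mem (hpm z hz) (hpm w hw))
          (by rw [QuadraticMap.polar_add_right, hproj, hproj, add_zero])
        rw [norm_add, h0, h1, zero_add, zero_add] at h01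
        have hw' : w = (w - (polar n x w / (2 * n x)) • x) + (polar n x w / (2 * n x)) • x := by
          abel
        rw [hw', QuadraticMap.polar_add_right, h01, QuadraticMap.polar_smul_right,
          QuadraticMap.polar_comm n _ x, hproj, smul_zero, add_zero]
      obtain ⟨c, hc⟩ := hline _ (hmul x hx x hx)
      have hc0 : c ≠ 0 := fun h0 => by
        rw [h0, zero_smul] at hc
        have := hn.norm_mul x x
        rw [hc, QuadraticMap.map_zero] at this
        exact mul_ne_zero hnx hnx this.symm
      have hx0 : x ≠ 0 := fun h0 => hnx (by rw [h0, QuadraticMap.map_zero])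
      refine ⟨c⁻¹ • x, Q.smul_mem _ hx, smul_ne_zero (inv_ne_zero hc0) hx0, ?_, fun z hz => ?_⟩
      · rw [smul_mul_smul_comm, hc, smul_smul]
        congr 1
        field_simp
      · obtain ⟨d, rfl⟩ := hline z hz
        rw [smul_mul_smul_comm, smul_mul_smul_comm, mul_comm]

/-- A proper nondegenerate subalgebra `Q` acts on its orthogonal complement, which contains a
vector that is not isotropic; so the dimension of `Q` is at most half of that of the algebra. -/
lemma finrank_le_four (hn : IsSymmComp n) (hdim : Module.finrank k S = 8) {Q : Submodule k S}
    (hmul : ∀ x ∈ Q, ∀ y ∈ Q, x * y ∈ Q)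
    (hnd : ∀ x ∈ Q, (∀ y ∈ Q, polar n x y = 0) → x = 0) (hQ : Q ≠ ⊤) :
    Module.finrank k Q ≤ 4 := by
  have : Module.Finite k S := Module.finite_of_finrank_pos (by omega)
  let B : LinearMap.BilinForm k S := QuadraticMap.polarBilin n
  have hB : ∀ x y, B x y = polar n x y := fun _ _ => rfl
  have hBs : B.IsRefl := fun x y h => by rw [hB, QuadraticMap.polar_comm]; exact h
  have hres : (B.restrict Q).Nondegenerate := by
    refine ⟨fun x hx => ?_, fun x hx => ?_⟩
    · exact Subtype.ext (hnd x x.2 fun y hy => hx ⟨y, hy⟩)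
    · exact Subtype.ext (hnd x x.2 fun y hy => by
        rw [QuadraticMap.polar_comm]; exact hx ⟨y, hy⟩)
  have hc := LinearMap.BilinForm.isCompl_orthogonal_of_restrict_nondegenerate hBs hres
  have hmem : ∀ {x}, x ∈ B.orthogonal Q ↔ ∀ q ∈ Q, polar n q x = 0 := Iff.rfl
  have hW : B.orthogonal Q ≠ ⊥ := fun h => hQ (by simpa [h] using hc.sup_eq_top)
  obtain ⟨u, hu, hnu⟩ := exists_norm_ne_zero (n := n) (W := B.orthogonal Q) (by
    intro x hx h
    refine hn.nondegenerate x fun y => ?_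
    obtain ⟨q, hq, w, hw, rfl⟩ := Submodule.mem_sup.1 (hc.sup_eq_top ▸ Submodule.mem_top : y ∈ _)
    rw [QuadraticMap.polar_add_right, h w hw, QuadraticMap.polar_comm, hmem.1 hx q hq, add_zero])
    hW
  let f : Q →ₗ[k] B.orthogonal Q :=
    ((LinearMap.mulRight k u).comp Q.subtype).codRestrict _ fun q => hmem.2 fun p hp => by
      have : polar n p ((q : S) * u) = polar n (p * q) u := (hn.polar_mul _ _ _).symm
      simpa [this] using hmem.1 hu _ (hmul p hp q q.2)
  have hf : Function.Injective f := by
    rw [injective_iff_map_eq_zero]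
    intro q hq
    exact Subtype.ext (hn.eq_zero_of_mul_eq_zero hnu (congrArg Subtype.val hq))
  have h1 := LinearMap.finrank_le_finrank_of_injective hf
  have h2 := Submodule.finrank_add_eq_of_isCompl hc
  omega

/-- A nonzero proper subalgebra on which the norm is nondegenerate is para-Hurwitz or a
commutative plane. If it is larger than a plane `P` spanned by `x` and `x * x`, it is `P ⊕ P * u`
for any `u` orthogonal to `P` with `n(u) ≠ 0`, and `-n(u)⁻¹ (u * u)` is a central idempotent. -/
theorem exists_central_idempotent_or_plane (hn : IsSymmComp n) (hdim : Module.finrank k S = 8)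
    {Q : Submodule k S} (hmul : ∀ x ∈ Q, ∀ y ∈ Q, x * y ∈ Q)
    (hnd : ∀ x ∈ Q, (∀ y ∈ Q, polar n x y = 0) → x = 0) (hQ : Q ≠ ⊥) (hQt : Q ≠ ⊤) :
    (∃ e ∈ Q, e ≠ 0 ∧ e * e = e ∧ ∀ x ∈ Q, e * x = x * e) ∨
      (Module.finrank k Q = 2 ∧ ∀ x ∈ Q, ∀ y ∈ Q, x * y = y * x) := by
  have hfin : Module.Finite k S := Module.finite_of_finrank_pos (by omega)
  rcases hn.exists_disc_ne_zero hmul hnd hQ with ⟨x, hx, hD⟩ | h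
  swap
  · exact Or.inl h
  have hxx := hmul x hx x hx
  set y := x * x with hy
  -- The Gram matrix of `x, y`.
  have bxx : polar n x x = 2 * n x := polar_self_eq n x
  have byy : polar n y y = 2 * n x ^ 2 := by rw [polar_self_eq, hy, hn.norm_mul]; ring
  have byx : polar n y x = polar n x y := QuadraticMap.polar_comm _ _ _
  have hxy : x * y = n x • x := hn.mul_mul_right x x
  have hyx : y * x = n x • x := hn.mul_mul_left x x
  have hind : ∀ c d : k, polar n (c • x + d • y) x = 0 → polar n (c • x + d • y) y = 0 →
      c = 0 ∧ d = 0 := by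
    intro c d h1 h2
    simp only [QuadraticMap.polar_add_left, QuadraticMap.polar_smul_left, smul_eq_mul, bxx, byy,
      byx] at h1 h2
    constructor
    · refine (mul_eq_zero.1 ?_).resolve_left hD
      linear_combination 2 * n x ^ 2 * h1 - polar n x y * h2
    · refine (mul_eq_zero.1 ?_).resolve_left hD
      linear_combination 2 * n x * h2 - polar n x y * h1
  have hproj : ∀ z : S, ∃ c d : k, polar n (z - (c • x + d • y)) x = 0 ∧
      polar n (z - (c • x + d • y)) y = 0 := by
    intro z
    have hδ := mul_inv_cancel₀ hD
    generalize (4 * n x ^ 3 - polar n x y ^ 2)⁻¹ = δ at hδ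
    refine ⟨(2 * n x ^ 2 * polar n z x - polar n x y * polar n z y) * δ,
      (2 * n x * polar n z y - polar n x y * polar n z x) * δ, ?_, ?_⟩
    · simp only [QuadraticMap.polar_sub_left, QuadraticMap.polar_add_left,
        QuadraticMap.polar_smul_left, smul_eq_mul, bxx, byx]
      linear_combination -polar n z x * hδ
    · simp only [QuadraticMap.polar_sub_left, QuadraticMap.polar_add_left,
        QuadraticMap.polar_smul_left, smul_eq_mul, byy]
      linear_combination -polar n z y * hδ
  by_cases hu : ∃ u ∈ Q, polar n u x = 0 ∧ polar n u y = 0 ∧ n u ≠ 0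
  · left
    obtain ⟨u, hu, hux, huy, hnu⟩ := hu
    have hperp : ∀ c d : k, polar n u (c • x + d • y) = 0 := fun c d => by
      rw [QuadraticMap.polar_add_right, QuadraticMap.polar_smul_right,
        QuadraticMap.polar_smul_right, hux, huy, smul_zero, smul_zero, add_zero]
    -- `P * u` is orthogonal to `P`.
    have hPP : ∀ c d c' d' : k, ∃ a b : k,
        (c • x + d • y) * (c' • x + d' • y) = a • x + b • y := by
      intro c d c' d'
      refine ⟨c * d' * n x + d * c' * n x + d * d' * polar n x y, c * c' - d * d' * n x, ?_⟩
      have hyy : y * y = polar n x y • x - n x • y := hn.sq_mul_sq x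
      simp only [add_mul, mul_add, smul_mul_assoc, mul_smul_comm, hxy, hyx, hyy, ← hy]
      module
    have hPu : ∀ c d c' d' : k,
        polar n ((c • x + d • y) * u) (c' • x + d' • y) = 0 := by
      intro c d c' d'
      obtain ⟨a, b, hab⟩ := hPP c' d' c d
      rw [QuadraticMap.polar_comm, ← hn.polar_mul, hab, QuadraticMap.polar_comm, hperp]
    have hli : LinearIndependent k ![x, y, x * u, y * u] := by
      rw [Fintype.linearIndependent_iff]
      intro g hg
      simp only [Fin.sum_univ_four, Matrix.cons_val_zero, Matrix.cons_val_one, Matrix.cons_val]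
        at hg
      have hg' : g 0 • x + g 1 • y + (g 2 • x + g 3 • y) * u = 0 := by
        rw [← hg, add_mul, smul_mul_assoc, smul_mul_assoc]
        abel
      have key : ∀ c d : k, polar n (g 0 • x + g 1 • y) (c • x + d • y) = 0 := fun c d => by
        rw [eq_neg_of_add_eq_zero_left hg', QuadraticMap.polar_neg_left, hPu, neg_zero]
      obtain ⟨h0, h1⟩ := hind (g 0) (g 1) (by simpa using key 1 0) (by simpa using key 0 1)
      rw [h0, h1, zero_smul, zero_smul, zero_add, zero_add] at hg'
      have hg'' := hn.eq_zero_of_mul_eq_zero hnu hg'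
      obtain ⟨h2, h3⟩ := hind (g 2) (g 3) (by rw [hg'', QuadraticMap.polar_zero_left])
        (by rw [hg'', QuadraticMap.polar_zero_left])
      intro i
      fin_cases i <;> assumption
    have hspan : Submodule.span k (Set.range ![x, y, x * u, y * u]) = Q := by
      refine Submodule.eq_of_le_of_finrank_le ?_ ?_
      · rw [Submodule.span_le]
        rintro _ ⟨i, rfl⟩
        fin_cases i
        exacts [hx, hxx, hmul x hx u hu, hmul y hxx u hu]
      · rw [finrank_span_eq_card hli, Fintype.card_fin]
        exact hn.finrank_le_four hdim hmul hnd hQt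
    have hmem : ∀ z ∈ Q, ∃ a b c d : k, z = (a • x + b • y) + (c • x + d • y) * u := by
      intro z hz
      rw [← hspan, Submodule.mem_span_range_iff_exists_fun] at hz
      obtain ⟨c, rfl⟩ := hz
      refine ⟨c 0, c 1, c 2, c 3, ?_⟩
      simp only [Fin.sum_univ_four, Matrix.cons_val_zero, Matrix.cons_val_one, Matrix.cons_val,
        add_mul, smul_mul_assoc]
      abel
    -- As `n(u * u, p * u) = n(u) n(u, p) = 0` for `p` in `P`, the square of `u` lies in `P`.
    obtain ⟨a, b, huu⟩ : ∃ a b : k, u * u = a • x + b • y := by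
      obtain ⟨a, b, c, d, h⟩ := hmem _ (hmul u hu u hu)
      have key : ∀ c' d' : k, polar n (c • x + d • y) (c' • x + d' • y) = 0 := fun c' d' => by
        have h1 := hn.polar_mul_mul_right u (c' • x + d' • y) u
        rw [hperp, mul_zero, h, QuadraticMap.polar_add_left, hn.polar_mul_mul_right,
          QuadraticMap.polar_comm, hPu, zero_add] at h1
        exact (mul_eq_zero.1 h1).resolve_left hnu
      obtain ⟨h2, h3⟩ := hind c d (by simpa using key 1 0) (by simpa using key 0 1)
      exact ⟨a, b, by rw [h, h2, h3, zero_smul, zero_smul, zero_add, zero_mul, add_zero]⟩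
    obtain ⟨he, he0⟩ := hn.isIdempotent_of_polar_sq_eq_zero hnu (by rw [huu]; exact hperp a b)
    have heQ : -(n u)⁻¹ • (u * u) ∈ Q := Q.smul_mem _ (hmul u hu u hu)
    have heu : (-(n u)⁻¹ • (u * u)) * u = -u := by
      rw [smul_mul_assoc, hn.mul_mul_left, smul_smul, neg_mul, inv_mul_cancel₀ hnu, neg_smul,
        one_smul]
    have hue : u * (-(n u)⁻¹ • (u * u)) = -u := by
      rw [mul_smul_comm, hn.mul_mul_right, smul_smul, neg_mul, inv_mul_cancel₀ hnu, neg_smul,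
        one_smul]
    have hzero : polar n (-(n u)⁻¹ • (u * u)) u = 0 := by
      rw [QuadraticMap.polar_comm, QuadraticMap.polar_smul_right, huu, hperp, smul_zero]
    have heP : ∀ c d : k, (-(n u)⁻¹ • (u * u)) * (c • x + d • y) =
        (c • x + d • y) * (-(n u)⁻¹ • (u * u)) := by
      intro c d
      rw [huu]
      simp only [add_mul, mul_add, smul_mul_assoc, mul_smul_comm, hxy, hyx]
      module
    generalize -(n u)⁻¹ • (u * u) = e at *
    have hne := hn.norm_eq_one_of_isIdempotent he he0
    refine ⟨e, heQ, he0, he, fun z hz => ?_⟩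
    obtain ⟨a, b, c, d, rfl⟩ := hmem z hz
    -- On `P` the multiplication by `e` is the reflection `p ↦ n(p, e) e - p`.
    have hpe : ∀ c d : k, (c • x + d • y) * e =
        polar n (c • x + d • y) e • e - (c • x + d • y) := by
      intro c d
      have h1 := hn.mul_mul_add (c • x + d • y) e e
      have h2 := hn.mul_mul_left e (c • x + d • y)
      rw [← heP, h2, he, hne, one_smul, heP] at h1
      rw [← h1]
      abel
    have h1 := hpe c d
    have h2 := heP a b
    generalize c • x + d • y = p at h1 ⊢
    generalize a • x + b • y = q at h2 ⊢
    rw [mul_add, add_mul, h2, hn.mul_mul_eq' e p u, hn.mul_mul_eq p u e, hzero, h1, heu,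
      mul_sub, mul_smul_comm, hue, neg_mul]
    module
  · right
    push Not at hu
    have hmem : ∀ z ∈ Q, ∃ c d : k, z = c • x + d • y := by
      have hm : ∀ z ∈ Q, ∀ c d : k, z - (c • x + d • y) ∈ Q := fun z hz c d =>
        Q.sub_mem hz (Q.add_mem (Q.smul_mem _ hx) (Q.smul_mem _ hxx))
      intro z hz
      obtain ⟨c, d, h1, h2⟩ := hproj z
      refine ⟨c, d, sub_eq_zero.1 (hnd _ (hm z hz c d) fun w hw => ?_)⟩
      obtain ⟨c', d', h1', h2'⟩ := hproj w
      have h3 := hu _ (hm z hz c d) h1 h2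
      have h4 := hu _ (hm w hw c' d') h1' h2'
      have h5 := hu _ (Q.add_mem (hm z hz c d) (hm w hw c' d'))
        (by rw [QuadraticMap.polar_add_left, h1, h1', add_zero])
        (by rw [QuadraticMap.polar_add_left, h2, h2', add_zero])
      rw [norm_add, h3, h4, zero_add, zero_add] at h5
      have hw' : w = (w - (c' • x + d' • y)) + (c' • x + d' • y) := by abel
      rw [hw', QuadraticMap.polar_add_right, h5, QuadraticMap.polar_add_right,
        QuadraticMap.polar_smul_right, QuadraticMap.polar_smul_right, h1, h2, smul_zero,
        smul_zero, add_zero, add_zero]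
    have hli : LinearIndependent k ![x, y] := by
      rw [LinearIndependent.pair_iff]
      intro c d h
      exact hind c d (by rw [h, QuadraticMap.polar_zero_left])
        (by rw [h, QuadraticMap.polar_zero_left])
    have hspan : Submodule.span k (Set.range ![x, y]) = Q := by
      refine le_antisymm ?_ fun z hz => ?_
      · rw [Submodule.span_le]
        rintro _ ⟨i, rfl⟩
        fin_cases i
        exacts [hx, hxx]
      · rw [Submodule.mem_span_range_iff_exists_fun]
        obtain ⟨c, d, rfl⟩ := hmem z hz
        exact ⟨![c, d], by simp⟩
    refine ⟨?_, fun z hz w hw => ?_⟩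
    · rw [← hspan, finrank_span_eq_card hli, Fintype.card_fin]
    · obtain ⟨c, d, rfl⟩ := hmem z hz
      obtain ⟨c', d', rfl⟩ := hmem w hw
      simp only [add_mul, mul_add, smul_mul_assoc, mul_smul_comm, hxy, hyx]
      module

end IsSymmComp

/-! ### Para-Hurwitz algebras -/

/-- `e` is a para-unit of the symmetric composition algebra `(A, *, n)`: a nonzero idempotent that
commutes with every element. -/
structure IsParaUnit {k : Type u} [Field k] {A : Type v} [NonUnitalNonAssocRing A] [Module k A]
    (n : QuadraticForm k A) (e : A) : Prop where
  isSymmComp : IsSymmComp n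
  ne_zero : e ≠ 0
  idem : e * e = e
  comm : ∀ x : A, e * x = x * e

namespace IsParaUnit

variable {k : Type u} [Field k] {A : Type v} [NonUnitalNonAssocRing A] [Module k A]
  {n : QuadraticForm k A} {e : A}

lemma norm_eq_one (h : IsParaUnit n e) : n e = 1 :=
  h.isSymmComp.norm_eq_one_of_isIdempotent h.idem h.ne_zero

lemma mul_mul_self (h : IsParaUnit n e) (x : A) : e * (x * e) = x := by
  rw [h.isSymmComp.mul_mul_right, h.norm_eq_one, one_smul]

lemma mul_mul_self' (h : IsParaUnit n e) (x : A) : (e * x) * e = x := by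
  rw [h.isSymmComp.mul_mul_left, h.norm_eq_one, one_smul]

/-- Multiplication by the para-unit is the conjugation of the associated Hurwitz algebra. -/
lemma mul_eq (h : IsParaUnit n e) (x : A) : e * x = polar n x e • e - x := by
  have h1 := h.isSymmComp.mul_mul_add x e e
  rw [h.idem, ← h.comm x, h.mul_mul_self'] at h1
  rw [← h1, add_sub_cancel_left]

/-- The underlying space of the Hurwitz algebra of a symmetric composition algebra with
para-unit `e`; its product is `(e * x) * (y * e)` and its unit is `e`. -/
def Hurwitz (_h : IsParaUnit n e) : Type v := A

instance (h : IsParaUnit n e) : AddCommGroup h.Hurwitz := inferInstanceAs (AddCommGroup A)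

instance (h : IsParaUnit n e) : Module k h.Hurwitz := inferInstanceAs (Module k A)

/-- The identity map from the symmetric composition algebra to its Hurwitz algebra. -/
def toHurwitz (h : IsParaUnit n e) : A ≃ₗ[k] h.Hurwitz := LinearEquiv.refl k A

instance (h : IsParaUnit n e) : Mul h.Hurwitz where
  mul x y := h.toHurwitz ((e * h.toHurwitz.symm x) * (h.toHurwitz.symm y * e))

instance (h : IsParaUnit n e) : One h.Hurwitz where
  one := h.toHurwitz e

lemma hurwitz_mul_def (h : IsParaUnit n e) (x y : h.Hurwitz) :
    x * y = h.toHurwitz ((e * h.toHurwitz.symm x) * (h.toHurwitz.symm y * e)) := rfl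

lemma hurwitz_one_def (h : IsParaUnit n e) : (1 : h.Hurwitz) = h.toHurwitz e := rfl

instance (h : IsParaUnit n e) : NonAssocRing h.Hurwitz where
  left_distrib x y z := by simp only [hurwitz_mul_def, map_add, add_mul, mul_add]
  right_distrib x y z := by simp only [hurwitz_mul_def, map_add, add_mul, mul_add]
  zero_mul x := by simp only [hurwitz_mul_def, map_zero, mul_zero, zero_mul]
  mul_zero x := by simp only [hurwitz_mul_def, map_zero, mul_zero, zero_mul]
  one_mul x := by
    rw [hurwitz_mul_def, hurwitz_one_def, LinearEquiv.symm_apply_apply, h.idem, h.mul_mul_self,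
      LinearEquiv.apply_symm_apply]
  mul_one x := by
    rw [hurwitz_mul_def, hurwitz_one_def, LinearEquiv.symm_apply_apply, h.idem, h.mul_mul_self',
      LinearEquiv.apply_symm_apply]

/-- The norm of the Hurwitz algebra. -/
def hurwitzNorm (h : IsParaUnit n e) : QuadraticForm k h.Hurwitz :=
  n.comp (h.toHurwitz.symm : h.Hurwitz →ₗ[k] A)

lemma hurwitzNorm_apply (h : IsParaUnit n e) (x : h.Hurwitz) :
    h.hurwitzNorm x = n (h.toHurwitz.symm x) := rfl

theorem isParaHurwitz [IsScalarTower k A A] [SMulCommClass k A A] (h : IsParaUnit n e) :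
    IsParaHurwitz n := by
  refine ⟨h.Hurwitz, inferInstance, ⟨h.toHurwitz e, h.toHurwitz 0, fun h' =>
    h.ne_zero (h.toHurwitz.injective h')⟩, inferInstance, ⟨fun c x y => ?_⟩, ⟨fun c x y => ?_⟩,
    h.hurwitzNorm, ⟨fun x y => ?_, fun x hx => ?_⟩, h.toHurwitz, fun x => rfl, fun x y => ?_⟩
  · simp only [smul_eq_mul, hurwitz_mul_def, map_smul, smul_mul_assoc, mul_smul_comm]
  · simp only [smul_eq_mul, hurwitz_mul_def, map_smul, smul_mul_assoc, mul_smul_comm]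
  · simp only [hurwitzNorm_apply, hurwitz_mul_def, LinearEquiv.symm_apply_apply,
      h.isSymmComp.norm_mul, h.norm_eq_one, one_mul, mul_one]
  · refine h.toHurwitz.symm.injective ?_
    rw [map_zero]
    exact h.isSymmComp.nondegenerate _ fun y => hx (h.toHurwitz y)
  · have hconj : ∀ x, conj h.hurwitzNorm (h.toHurwitz x) = h.toHurwitz (e * x) := fun x => by
      rw [h.mul_eq, map_sub, map_smul]
      rfl
    rw [hconj, hconj, hurwitz_mul_def, LinearEquiv.symm_apply_apply, LinearEquiv.symm_apply_apply,
      h.comm x, h.mul_mul_self, h.mul_mul_self']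

end IsParaUnit

/-- The unit of the Hurwitz algebra is a nonzero idempotent of a para-Hurwitz algebra. -/
theorem IsParaHurwitz.exists_isIdempotent {k : Type u} [Field k] {A : Type v}
    [NonUnitalNonAssocRing A] [Module k A] {n : QuadraticForm k A} (h : IsParaHurwitz n) :
    ∃ e : A, e ≠ 0 ∧ e * e = e := by
  obtain ⟨C, _, _, _, _, _, N, hN, φ, -, hφ⟩ := h
  have h1 : N 1 = 1 := by
    have hne : N 1 ≠ 0 := fun h0 => by
      have hz : ∀ x, N x = 0 := fun x => by
        rw [← mul_one x, hN.norm_mul, h0, mul_zero]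
      exact one_ne_zero (hN.nondegenerate 1 fun y => by simp [polar, hz])
    have := hN.norm_mul 1 1
    rw [mul_one] at this
    exact mul_left_cancel₀ hne (by rw [← this, mul_one])
  have hc : conj N (1 : C) = 1 := by
    rw [conj, QuadraticMap.polar_self, h1, nsmul_eq_mul, mul_one, Nat.cast_ofNat, two_smul,
      add_sub_cancel_right]
  refine ⟨φ.symm 1, fun h0 => one_ne_zero (φ.symm.map_eq_zero_iff.1 h0), φ.injective ?_⟩
  rw [hφ, LinearEquiv.apply_symm_apply, hc, mul_one]

/-! ### Recognizing the algebra `O_{α,β}` -/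


lemma OkuboAlgebra.coord_x (α β : k) (t r : Fin 8) :
    coord t (x α β r) = if t = r then 1 else 0 :=
  show (Pi.single r 1 : Fin 8 → k) t = _ from Pi.single_apply r 1 t

/-- Elements `a, a', b, b'` of a symmetric composition algebra that behave like the elements
`x_{1,0}, x_{-1,0}, x_{0,1}, x_{0,-1}` of `O_{α,β}`. The relations are those that do not follow
from the axioms of symmetric composition algebras. -/
structure IsOkuboFrame (n : QuadraticForm k S) (a a' b b' : S) (α β : k) : Prop where
  isSymmComp : IsSymmComp n
  left_ne_zero : α ≠ 0
  right_ne_zero : β ≠ 0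
  norm_a : n a = 0
  norm_b : n b = 0
  sq_a : a * a = -α • a'
  sq_b : b * b = -β • b'
  polar_ab : polar n a b = 0
  polar_aa' : polar n a a' = 1
  polar_bb' : polar n b b' = 1
  mul_ab : a * b = 0

/-- A frame from two elements. -/
lemma IsSymmComp.isOkuboFrame (hn : IsSymmComp n) {a b : S} {α β : k} (hα : α ≠ 0) (hβ : β ≠ 0)
    (ha : n a = 0) (hb : n b = 0) (hga : polar n a (a * a) = -α) (hgb : polar n b (b * b) = -β)
    (hab : polar n a b = 0) (hm : a * b = 0) :
    IsOkuboFrame n a (-α⁻¹ • (a * a)) b (-β⁻¹ • (b * b)) α β where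
  isSymmComp := hn
  left_ne_zero := hα
  right_ne_zero := hβ
  norm_a := ha
  norm_b := hb
  sq_a := by rw [smul_smul, neg_mul_neg, mul_inv_cancel₀ hα, one_smul]
  sq_b := by rw [smul_smul, neg_mul_neg, mul_inv_cancel₀ hβ, one_smul]
  polar_ab := hab
  polar_aa' := by
    rw [QuadraticMap.polar_smul_right, hga, smul_eq_mul, neg_mul_neg, inv_mul_cancel₀ hα]
  polar_bb' := by
    rw [QuadraticMap.polar_smul_right, hgb, smul_eq_mul, neg_mul_neg, inv_mul_cancel₀ hβ]
  mul_ab := hm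

namespace IsOkuboFrame

variable [IsScalarTower k S S] [SMulCommClass k S S] {a a' b b' : S} {α β : k}

lemma eq_a' (h : IsOkuboFrame n a a' b b' α β) : a' = -α⁻¹ • (a * a) := by
  rw [h.sq_a, smul_smul, neg_mul_neg, inv_mul_cancel₀ h.left_ne_zero, one_smul]

lemma eq_b' (h : IsOkuboFrame n a a' b b' α β) : b' = -β⁻¹ • (b * b) := by
  rw [h.sq_b, smul_smul, neg_mul_neg, inv_mul_cancel₀ h.right_ne_zero, one_smul]

lemma mul_aa' (h : IsOkuboFrame n a a' b b' α β) : a * a' = 0 := by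
  rw [h.eq_a', mul_smul_comm, h.isSymmComp.mul_mul_right, h.norm_a, zero_smul, smul_zero]

lemma polar_aa (h : IsOkuboFrame n a a' b b' α β) : polar n a a = 0 := by
  rw [polar_self_eq, h.norm_a, mul_zero]

/-- The defining relations are invariant under the rotation
`x_{1,0} ↦ x_{0,1} ↦ x_{-1,0} ↦ x_{0,-1} ↦ x_{1,0}`, which maps `O_{β,α⁻¹}` to `O_{α,β}`. This
reduces the multiplication table to the rows of `x_{1,0}` and `x_{1,1}`. -/
lemma rot (h : IsOkuboFrame n a a' b b' α β) : IsOkuboFrame n b b' a' a β α⁻¹ where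
  isSymmComp := h.isSymmComp
  left_ne_zero := h.right_ne_zero
  right_ne_zero := inv_ne_zero h.left_ne_zero
  norm_a := h.norm_b
  norm_b := by
    rw [h.eq_a', norm_smul, h.isSymmComp.norm_mul, h.norm_a, zero_mul, mul_zero]
  sq_a := h.sq_b
  sq_b := by
    have hα := h.left_ne_zero
    have h1 := h.isSymmComp.sq_mul_sq a
    rw [h.norm_a, zero_smul, sub_zero, h.sq_a, QuadraticMap.polar_smul_right, h.polar_aa',
      smul_mul_smul_comm] at h1
    have h2 : a' * a' = (α⁻¹ * α⁻¹) • (-α * -α) • (a' * a') := by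
      rw [smul_smul, show α⁻¹ * α⁻¹ * (-α * -α) = 1 by field_simp, one_smul]
    rw [h2, h1, smul_smul]
    congr 1
    simp only [smul_eq_mul]
    field_simp
  polar_ab := by
    rw [h.eq_a', QuadraticMap.polar_smul_right, QuadraticMap.polar_comm, h.isSymmComp.polar_mul,
      h.mul_ab, QuadraticMap.polar_zero_right, smul_zero]
  polar_aa' := h.polar_bb'
  polar_bb' := by rw [QuadraticMap.polar_comm, h.polar_aa']
  mul_ab := by
    rw [h.eq_a', mul_smul_comm, h.isSymmComp.mul_mul_eq' b a a, h.mul_ab, mul_zero, sub_zero,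
      QuadraticMap.polar_comm, h.polar_ab, zero_smul, smul_zero]

lemma polar_ab' (h : IsOkuboFrame n a a' b b' α β) : polar n a b' = 0 := by
  rw [QuadraticMap.polar_comm, h.rot.rot.rot.polar_ab]

lemma mul_ac (h : IsOkuboFrame n a a' b b' α β) : a * (b * a) = 0 := by
  rw [h.isSymmComp.mul_mul_right, h.norm_a, zero_smul]

lemma mul_ac' (h : IsOkuboFrame n a a' b b' α β) : a * (b' * a') = b' := by
  rw [h.isSymmComp.mul_mul_eq', h.polar_aa', h.rot.rot.rot.mul_ab, mul_zero, sub_zero, one_smul]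

lemma mul_ad (h : IsOkuboFrame n a a' b b' α β) : a * (a' * b) = 0 := by
  rw [h.isSymmComp.mul_mul_eq', h.polar_ab, h.rot.rot.mul_aa', mul_zero, sub_zero, zero_smul]

lemma mul_ad' (h : IsOkuboFrame n a a' b b' α β) : a * (a * b') = α • (b' * a') := by
  rw [h.isSymmComp.mul_mul_eq', h.polar_ab', h.sq_a, zero_smul, zero_sub, mul_smul_comm, neg_smul,
    neg_neg]

lemma mul_ca (h : IsOkuboFrame n a a' b b' α β) : (b * a) * a = α • (a' * b) := by
  rw [h.isSymmComp.mul_mul_eq, QuadraticMap.polar_comm, h.polar_ab, h.sq_a, zero_smul, zero_sub,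
    smul_mul_assoc, neg_smul, neg_neg]

lemma mul_ca' (h : IsOkuboFrame n a a' b b' α β) : (b * a) * a' = 0 := by
  rw [h.isSymmComp.mul_mul_eq, h.rot.polar_ab, h.rot.rot.mul_aa', zero_smul, zero_mul, sub_zero]

lemma mul_cb (h : IsOkuboFrame n a a' b b' α β) : (b * a) * b = 0 := by
  rw [h.isSymmComp.mul_mul_left, h.norm_b, zero_smul]

lemma mul_cb' (h : IsOkuboFrame n a a' b b' α β) : (b * a) * b' = a := by
  rw [h.isSymmComp.mul_mul_eq, h.polar_bb', h.rot.rot.rot.mul_ab, zero_mul, sub_zero, one_smul]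

lemma polar_ac (h : IsOkuboFrame n a a' b b' α β) : polar n a (b * a) = 0 := by
  rw [← h.isSymmComp.polar_mul, h.mul_ab, QuadraticMap.polar_zero_left]

lemma polar_ad (h : IsOkuboFrame n a a' b b' α β) : polar n a (a' * b) = 0 := by
  rw [← h.isSymmComp.polar_mul, h.mul_aa', QuadraticMap.polar_zero_left]

lemma polar_ac' (h : IsOkuboFrame n a a' b b' α β) : polar n a (b' * a') = 0 := by
  rw [QuadraticMap.polar_comm, h.isSymmComp.polar_mul, h.rot.rot.mul_aa',
    QuadraticMap.polar_zero_right]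

lemma polar_ad' (h : IsOkuboFrame n a a' b b' α β) : polar n a (a * b') = 0 := by
  rw [QuadraticMap.polar_comm, h.isSymmComp.polar_mul, h.rot.rot.rot.mul_ab,
    QuadraticMap.polar_zero_right]

lemma polar_cc' (h : IsOkuboFrame n a a' b b' α β) : polar n (b * a) (b' * a') = 1 := by
  rw [h.isSymmComp.polar_mul, h.mul_ac', h.polar_bb']

lemma polar_cd (h : IsOkuboFrame n a a' b b' α β) : polar n (b * a) (a' * b) = 0 := by
  rw [h.isSymmComp.polar_mul, h.mul_ad, QuadraticMap.polar_zero_right]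

lemma polar_cd' (h : IsOkuboFrame n a a' b b' α β) : polar n (b * a) (a * b') = 0 := by
  rw [h.isSymmComp.polar_mul, h.mul_ad', QuadraticMap.polar_smul_right, h.rot.polar_ad, smul_zero]

lemma norm_c (h : IsOkuboFrame n a a' b b' α β) : n (b * a) = 0 := by
  rw [h.isSymmComp.norm_mul, h.norm_a, mul_zero]

lemma mul_cc (h : IsOkuboFrame n a a' b b' α β) :
    (b * a) * (b * a) = -(α * β) • (b' * a') := by
  rw [h.isSymmComp.mul_mul_eq b a (b * a), h.mul_ca, smul_mul_assoc, h.rot.mul_ca, h.rot.polar_ad',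
    zero_smul, zero_sub, smul_smul, neg_smul]

lemma mul_cc' (h : IsOkuboFrame n a a' b b' α β) : (b * a) * (b' * a') = 0 := by
  rw [h.isSymmComp.mul_mul_eq' (b * a), h.rot.rot.rot.mul_ad, mul_zero, sub_zero,
    QuadraticMap.polar_comm, h.rot.rot.polar_ac', zero_smul]

lemma mul_cd (h : IsOkuboFrame n a a' b b' α β) : (b * a) * (a' * b) = β • b' := by
  rw [h.isSymmComp.mul_mul_eq' (b * a), h.rot.rot.mul_ac', h.sq_b, QuadraticMap.polar_comm,
    h.rot.polar_ad', zero_smul, zero_sub, neg_smul, neg_neg]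

lemma mul_cd' (h : IsOkuboFrame n a a' b b' α β) : (b * a) * (a * b') = 0 := by
  rw [h.isSymmComp.mul_mul_eq' (b * a), h.mul_ac, mul_zero, sub_zero,
    QuadraticMap.polar_comm, h.rot.rot.rot.polar_ad, zero_smul]

/-- The elements `x_{i,j}` that belong to a frame, in the order of `OkuboAlgebra.idx`. -/
def vec (a a' b b' : S) : Fin 8 → S := ![a, a', b, b', b * a, b' * a', a' * b, a * b']

/-- The position of `x_{i+k,j+l}`, from those of `x_{i,j}` and `x_{k,l}`. The value is meaningless
if `(i + k, j + l) = (0, 0)`, where the product of the two basis elements vanishes. -/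
def addIdx : Matrix (Fin 8) (Fin 8) (Fin 8) :=
  !![1, 0, 4, 7, 6, 3, 2, 5;
     0, 0, 6, 5, 2, 7, 4, 3;
     4, 6, 3, 0, 7, 1, 5, 0;
     7, 5, 0, 2, 0, 6, 1, 4;
     6, 2, 7, 0, 5, 0, 3, 1;
     3, 7, 1, 6, 0, 4, 0, 2;
     2, 4, 5, 1, 3, 0, 7, 0;
     5, 3, 0, 4, 1, 2, 0, 6]

lemma idx_add (r s : Fin 8) : OkuboAlgebra.idx r + OkuboAlgebra.idx s = 0 ∨
    ∀ t, OkuboAlgebra.idx r + OkuboAlgebra.idx s = OkuboAlgebra.idx t ↔ t = addIdx r s := by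
  revert r s
  decide

lemma table_eq_zero (α β : k) {r s : Fin 8} (h : OkuboAlgebra.idx r + OkuboAlgebra.idx s = 0) :
    OkuboAlgebra.table α β r s = 0 := by
  have : (r, s) ∈ ({(0, 1), (1, 0), (2, 3), (3, 2), (4, 5), (5, 4), (6, 7), (7, 6)} :
      Finset (Fin 8 × Fin 8)) := by
    revert h
    revert r s
    decide
  simp only [Finset.mem_insert, Finset.mem_singleton, Prod.mk.injEq] at this
  rcases this with ⟨rfl, rfl⟩ | ⟨rfl, rfl⟩ | ⟨rfl, rfl⟩ | ⟨rfl, rfl⟩ | ⟨rfl, rfl⟩ | ⟨rfl, rfl⟩ |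
    ⟨rfl, rfl⟩ | ⟨rfl, rfl⟩ <;> rfl

/-- The elements of a frame multiply according to the table of `O_{α,β}`. -/
lemma vec_mul_vec (h : IsOkuboFrame n a a' b b' α β) (r s : Fin 8) :
    vec a a' b b' r * vec a a' b b' s = OkuboAlgebra.table α β r s • vec a a' b b' (addIdx r s) := by
  have h1 := h.rot
  have h2 := h1.rot
  have h3 := h2.rot
  have ec := h3.mul_cc
  have eg := h3.mul_cd
  simp only [inv_inv] at ec eg
  fin_cases r
  · fin_cases s
    · exact h.sq_a
    · exact h.mul_aa'.trans (zero_smul _ _).symm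
    · exact h.mul_ab.trans (zero_smul _ _).symm
    · exact (one_smul _ _).symm
    · exact h.mul_ac.trans (zero_smul _ _).symm
    · exact h.mul_ac'.trans (one_smul _ _).symm
    · exact h.mul_ad.trans (zero_smul _ _).symm
    · exact h.mul_ad'
  · fin_cases s
    · exact h2.mul_aa'.trans (zero_smul _ _).symm
    · exact h2.sq_a
    · exact (one_smul _ _).symm
    · exact h2.mul_ab.trans (zero_smul _ _).symm
    · exact h2.mul_ac'.trans (one_smul _ _).symm
    · exact h2.mul_ac.trans (zero_smul _ _).symm
    · exact h2.mul_ad'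
    · exact h2.mul_ad.trans (zero_smul _ _).symm
  · fin_cases s
    · exact (one_smul _ _).symm
    · exact h1.mul_ab.trans (zero_smul _ _).symm
    · exact h1.sq_a
    · exact h1.mul_aa'.trans (zero_smul _ _).symm
    · exact h1.mul_ad'
    · exact h1.mul_ad.trans (zero_smul _ _).symm
    · exact h1.mul_ac.trans (zero_smul _ _).symm
    · exact h1.mul_ac'.trans (one_smul _ _).symm
  · fin_cases s
    · exact h3.mul_ab.trans (zero_smul _ _).symm
    · exact (one_smul _ _).symm
    · exact h3.mul_aa'.trans (zero_smul _ _).symm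
    · exact h3.sq_a
    · exact h3.mul_ad.trans (zero_smul _ _).symm
    · exact h3.mul_ad'
    · exact h3.mul_ac'.trans (one_smul _ _).symm
    · exact h3.mul_ac.trans (zero_smul _ _).symm
  · fin_cases s
    · exact h.mul_ca
    · exact h.mul_ca'.trans (zero_smul _ _).symm
    · exact h.mul_cb.trans (zero_smul _ _).symm
    · exact h.mul_cb'.trans (one_smul _ _).symm
    · exact h.mul_cc
    · exact h.mul_cc'.trans (zero_smul _ _).symm
    · exact h.mul_cd
    · exact h.mul_cd'.trans (zero_smul _ _).symm
  · fin_cases s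
    · exact h2.mul_ca'.trans (zero_smul _ _).symm
    · exact h2.mul_ca
    · exact h2.mul_cb'.trans (one_smul _ _).symm
    · exact h2.mul_cb.trans (zero_smul _ _).symm
    · exact h2.mul_cc'.trans (zero_smul _ _).symm
    · refine h2.mul_cc.trans ?_
      change _ = (-(α * β)⁻¹) • _
      rw [mul_inv]
      rfl
    · exact h2.mul_cd'.trans (zero_smul _ _).symm
    · exact h2.mul_cd
  · fin_cases s
    · exact h1.mul_cb'.trans (one_smul _ _).symm
    · exact h1.mul_cb.trans (zero_smul _ _).symm
    · exact h1.mul_ca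
    · exact h1.mul_ca'.trans (zero_smul _ _).symm
    · exact h1.mul_cd'.trans (zero_smul _ _).symm
    · exact h1.mul_cd
    · refine h1.mul_cc.trans ?_
      rw [mul_comm]
      rfl
    · exact h1.mul_cc'.trans (zero_smul _ _).symm
  · fin_cases s
    · exact h3.mul_cb.trans (zero_smul _ _).symm
    · exact h3.mul_cb'.trans (one_smul _ _).symm
    · exact h3.mul_ca'.trans (zero_smul _ _).symm
    · exact h3.mul_ca
    · exact eg
    · exact h3.mul_cd'.trans (zero_smul _ _).symm
    · exact h3.mul_cc'.trans (zero_smul _ _).symm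
    · rw [mul_comm] at ec
      exact ec

lemma polar_cc (h : IsOkuboFrame n a a' b b' α β) : polar n (b * a) (b * a) = 0 := by
  rw [polar_self_eq, h.norm_c, mul_zero]

/-- The position of `x_{-i,-j}`. -/
def negIdx : Fin 8 → Fin 8 := ![1, 0, 3, 2, 5, 4, 7, 6]

lemma polar_vec (h : IsOkuboFrame n a a' b b' α β) (r s : Fin 8) :
    polar n (vec a a' b b' r) (vec a a' b b' s) = if s = negIdx r then 1 else 0 := by
  have h1 := h.rot
  have h2 := h1.rot
  have h3 := h2.rot
  fin_cases r
  · fin_cases s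
    exacts [h.polar_aa, h.polar_aa', h.polar_ab, h.polar_ab', h.polar_ac, h.polar_ac',
      h.polar_ad, h.polar_ad']
  · fin_cases s
    exacts [h2.polar_aa', h2.polar_aa, h2.polar_ab', h2.polar_ab, h2.polar_ac',
      h2.polar_ac, h2.polar_ad', h2.polar_ad]
  · fin_cases s
    exacts [h1.polar_ab', h1.polar_ab, h1.polar_aa, h1.polar_aa', h1.polar_ad',
      h1.polar_ad, h1.polar_ac, h1.polar_ac']
  · fin_cases s
    exacts [h3.polar_ab, h3.polar_ab', h3.polar_aa', h3.polar_aa, h3.polar_ad,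
      h3.polar_ad', h3.polar_ac', h3.polar_ac]
  · fin_cases s
    exacts [(QuadraticMap.polar_comm _ _ _).trans h.polar_ac,
      (QuadraticMap.polar_comm _ _ _).trans h2.polar_ac',
      (QuadraticMap.polar_comm _ _ _).trans h1.polar_ad',
      (QuadraticMap.polar_comm _ _ _).trans h3.polar_ad, h.polar_cc, h.polar_cc',
      h.polar_cd, h.polar_cd']
  · fin_cases s
    exacts [(QuadraticMap.polar_comm _ _ _).trans h.polar_ac',
      (QuadraticMap.polar_comm _ _ _).trans h2.polar_ac,
      (QuadraticMap.polar_comm _ _ _).trans h1.polar_ad,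
      (QuadraticMap.polar_comm _ _ _).trans h3.polar_ad', h2.polar_cc', h2.polar_cc,
      h2.polar_cd', h2.polar_cd]
  · fin_cases s
    exacts [(QuadraticMap.polar_comm _ _ _).trans h.polar_ad,
      (QuadraticMap.polar_comm _ _ _).trans h2.polar_ad',
      (QuadraticMap.polar_comm _ _ _).trans h1.polar_ac,
      (QuadraticMap.polar_comm _ _ _).trans h3.polar_ac', h1.polar_cd', h1.polar_cd,
      h1.polar_cc, h1.polar_cc']
  · fin_cases s
    exacts [(QuadraticMap.polar_comm _ _ _).trans h.polar_ad',
      (QuadraticMap.polar_comm _ _ _).trans h2.polar_ad,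
      (QuadraticMap.polar_comm _ _ _).trans h1.polar_ac',
      (QuadraticMap.polar_comm _ _ _).trans h3.polar_ac, h3.polar_cd, h3.polar_cd',
      h3.polar_cc', h3.polar_cc]

lemma norm_vec (h : IsOkuboFrame n a a' b b' α β) (r : Fin 8) : n (vec a a' b b' r) = 0 := by
  fin_cases r
  exacts [h.norm_a, h.rot.rot.norm_a, h.rot.norm_a, h.rot.rot.rot.norm_a, h.norm_c,
    h.rot.rot.norm_c, h.rot.norm_c, h.rot.rot.rot.norm_c]

/-- The linear map from `O_{α,β}` that maps the basis to the elements of a frame. -/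
def lift (a a' b b' : S) (α β : k) : OkuboAlgebra α β →ₗ[k] S :=
  Fintype.linearCombination k (vec a a' b b')

lemma lift_apply (f : OkuboAlgebra α β) :
    lift a a' b b' α β f = ∑ r, OkuboAlgebra.coord r f • vec a a' b b' r := rfl

lemma lift_x (r : Fin 8) : lift a a' b b' α β (OkuboAlgebra.x α β r) = vec a a' b b' r := by
  simp [lift_apply, OkuboAlgebra.coord_x]

lemma polar_lift (h : IsOkuboFrame n a a' b b' α β) (f : OkuboAlgebra α β) (r : Fin 8) :
    polar n (lift a a' b b' α β f) (vec a a' b b' r) = OkuboAlgebra.coord (negIdx r) f := by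
  have hr : ∀ s, r = negIdx s ↔ s = negIdx r := by
    revert r
    decide
  rw [lift_apply]
  change QuadraticMap.polarBilin n _ _ = _
  simp only [map_sum, LinearMap.sum_apply, map_smul, LinearMap.smul_apply,
    QuadraticMap.polarBilin_apply_apply, h.polar_vec, hr]
  simp

lemma norm_lift (h : IsOkuboFrame n a a' b b' α β) (f : OkuboAlgebra α β) :
    n (lift a a' b b' α β f) = OkuboAlgebra.norm f := by
  simp only [lift_apply, Fin.sum_univ_eight, norm_add, norm_smul, QuadraticMap.polar_add_left,
    QuadraticMap.polar_smul_left, QuadraticMap.polar_smul_right, h.norm_vec, h.polar_vec]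
  simp [negIdx, OkuboAlgebra.norm]
  ring

lemma lift_mul (h : IsOkuboFrame n a a' b b' α β) (f g : OkuboAlgebra α β) :
    lift a a' b b' α β (f * g) = lift a a' b b' α β f * lift a a' b b' α β g := by
  have key : ∀ r s, (∑ t, if OkuboAlgebra.idx r + OkuboAlgebra.idx s = OkuboAlgebra.idx t then
      OkuboAlgebra.table α β r s • vec a a' b b' t else 0) =
      vec a a' b b' r * vec a a' b b' s := by
    intro r s
    rw [h.vec_mul_vec]
    rcases idx_add r s with h0 | h0
    · simp [table_eq_zero α β h0]
    · simp [h0]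
  simp only [lift_apply, Finset.sum_mul_sum, smul_mul_smul_comm, ← key, OkuboAlgebra.coord_mul,
    Finset.sum_smul, Finset.smul_sum]
  rw [Finset.sum_comm]
  refine Finset.sum_congr rfl fun r _ => ?_
  rw [Finset.sum_comm]
  refine Finset.sum_congr rfl fun s _ => Finset.sum_congr rfl fun t _ => ?_
  split_ifs
  · rw [smul_smul]
  · rw [zero_smul, smul_zero]

/-- An eight-dimensional symmetric composition algebra with a frame is isomorphic
to `O_{α,β}`. -/
theorem exists_isOkuboIso (h : IsOkuboFrame n a a' b b' α β) (hdim : Module.finrank k S = 8) :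
    ∃ φ : S ≃ₗ[k] OkuboAlgebra α β, IsOkuboIso n φ ∧
      ∀ r, φ (vec a a' b b' r) = OkuboAlgebra.x α β r := by
  have hinj : Function.Injective (lift a a' b b' α β) := by
    rw [injective_iff_map_eq_zero]
    intro f hf
    refine OkuboAlgebra.ext fun r => ?_
    have hr : r = negIdx (negIdx r) := by
      revert r
      decide
    rw [hr, ← h.polar_lift, hf, QuadraticMap.polar_zero_left, map_zero]
  have hfin : Module.Finite k S := Module.finite_of_finrank_pos (by omega)
  have hfin' : Module.Finite k (OkuboAlgebra α β) :=
    inferInstanceAs (Module.Finite k (Fin 8 → k))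
  have hdim' : Module.finrank k (OkuboAlgebra α β) = 8 :=
    Module.finrank_fin_fun (R := k) (n := 8)
  let θ := LinearMap.linearEquivOfInjective (lift a a' b b' α β) hinj (hdim'.trans hdim.symm)
  have hθ : ∀ f, θ f = lift a a' b b' α β f := fun f => rfl
  refine ⟨θ.symm, ⟨fun x y => θ.injective ?_, fun x => ?_⟩, fun r => θ.injective ?_⟩
  · rw [LinearEquiv.apply_symm_apply, hθ, h.lift_mul, ← hθ, ← hθ, LinearEquiv.apply_symm_apply,
      LinearEquiv.apply_symm_apply]
  · rw [← h.norm_lift, ← hθ, LinearEquiv.apply_symm_apply]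
  · rw [LinearEquiv.apply_symm_apply, hθ, lift_x]

end IsOkuboFrame

/-! ### Gradings on symmetric composition algebras -/

variable {G : Type w} [AddGroup G] [DecidableEq G] {𝒮 : G → Submodule k S}

namespace IsGroupGrading

lemma eq_zero_of_mem_iSup (h : IsGroupGrading 𝒮) {a : G} {x : S} (hx : x ∈ 𝒮 a)
    (hx' : x ∈ ⨆ g, ⨆ (_ : g ≠ a), 𝒮 g) : x = 0 :=
  Submodule.disjoint_def.1 (h.isInternal.submodule_iSupIndep a) x hx hx'

lemma mem_iSup_ne {a g : G} {x : S} (hx : x ∈ 𝒮 g) (hg : g ≠ a) :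
    x ∈ ⨆ g, ⨆ (_ : g ≠ a), 𝒮 g :=
  Submodule.mem_iSup_of_mem g (Submodule.mem_iSup_of_mem hg hx)

lemma add_eq_zero_of_ne (h : IsGroupGrading 𝒮) {a b c : G} {x y : S} (hx : x ∈ 𝒮 b)
    (hy : y ∈ 𝒮 c) (hxy : x + y ∈ 𝒮 a) (hb : b ≠ a) (hc : c ≠ a) : x + y = 0 :=
  h.eq_zero_of_mem_iSup hxy (Submodule.add_mem _ (mem_iSup_ne hx hb) (mem_iSup_ne hy hc))

lemma eq_zero_of_mem (h : IsGroupGrading 𝒮) {a b : G} {x : S} (hx : x ∈ 𝒮 a) (hx' : x ∈ 𝒮 b)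
    (hab : a ≠ b) : x = 0 :=
  h.eq_zero_of_mem_iSup hx' (mem_iSup_ne hx hab)

/-- Components of degrees that are not opposite are orthogonal: apply
`(x * x) * y + (y * x) * x = n(x, y) x`. -/
lemma polar_eq_zero (h : IsGroupGrading 𝒮) (hn : IsSymmComp n) {a b : G} {x y : S}
    (hx : x ∈ 𝒮 a) (hy : y ∈ 𝒮 b) (hab : a + b ≠ 0) : polar n x y = 0 := by
  have h1 := hn.mul_mul_add x x y
  have hba : b + a ≠ 0 := fun h0 => hab (by
    rw [add_eq_zero_iff_eq_neg] at h0 ⊢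
    rw [h0, neg_neg])
  have h2 := h.add_eq_zero_of_ne (a := a) (h.mul_mem (h.mul_mem hx hx) hy)
    (h.mul_mem (h.mul_mem hy hx) hx) (by rw [h1]; exact (𝒮 a).smul_mem _ hx)
    (by rw [add_assoc]; simpa using hab) (by simpa using hba)
  rw [h1] at h2
  rcases smul_eq_zero.1 h2 with h0 | h0
  · exact h0
  · rw [h0, QuadraticMap.polar_zero_left]

lemma eq_zero_of_polar (h : IsGroupGrading 𝒮) (hn : IsSymmComp n) {a : G} {x : S}
    (hx : x ∈ 𝒮 a) (h0 : ∀ y ∈ 𝒮 (-a), polar n x y = 0) : x = 0 := by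
  refine hn.nondegenerate x fun y => ?_
  have hy : y ∈ ⨆ g, 𝒮 g := by
    rw [h.isInternal.submodule_iSup_eq_top]
    exact Submodule.mem_top
  induction hy using Submodule.iSup_induction' with
  | mem g z hz =>
    by_cases hg : g = -a
    · exact h0 z (hg ▸ hz)
    · exact h.polar_eq_zero hn hx hz fun h' => hg (eq_neg_of_add_eq_zero_right h')
  | zero => exact QuadraticMap.polar_zero_right _ _
  | add z w _ _ hz hw => rw [QuadraticMap.polar_add_right, hz, hw, add_zero]

lemma exists_polar_eq_one (h : IsGroupGrading 𝒮) (hn : IsSymmComp n) {a : G} {x : S}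
    (hx : x ∈ 𝒮 a) (hx0 : x ≠ 0) : ∃ y ∈ 𝒮 (-a), polar n x y = 1 := by
  by_contra! h'
  refine hx0 (h.eq_zero_of_polar hn hx fun y hy => ?_)
  by_contra h0
  refine h' _ ((𝒮 (-a)).smul_mem (polar n x y)⁻¹ hy) ?_
  rw [QuadraticMap.polar_smul_right, smul_eq_mul, inv_mul_cancel₀ h0]

/-- The degrees in the support commute: apply `(x * y) * z + (z * y) * x = n(x, z) y`. -/
lemma add_comm_of_mem (h : IsGroupGrading 𝒮) (hn : IsSymmComp n) {a b : G} {x y : S}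
    (hx : x ∈ 𝒮 a) (hx0 : x ≠ 0) (hy : y ∈ 𝒮 b) (hy0 : y ≠ 0) : a + b = b + a := by
  obtain ⟨z, hz, hxz⟩ := h.exists_polar_eq_one hn hx hx0
  have h1 := hn.mul_mul_add x y z
  rw [hxz, one_smul] at h1
  by_contra hne
  refine hy0 ?_
  rw [← h1]
  refine h.add_eq_zero_of_ne (a := b) (h.mul_mem (h.mul_mem hx hy) hz)
    (h.mul_mem (h.mul_mem hz hy) hx) (by rw [h1]; exact hy) (fun h' => hne ?_) fun h' => hne ?_
  · exact add_neg_eq_iff_eq_add.1 h'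
  · rw [add_assoc, neg_add_eq_iff_eq_add] at h'
    exact h'.symm

lemma exists_ne_zero (h : IsGroupGrading 𝒮) (h0 : 𝒮 0 ≠ ⊤) :
    ∃ a, a ≠ 0 ∧ ∃ x ∈ 𝒮 a, x ≠ 0 := by
  by_contra! h'
  refine h0 (top_unique ?_)
  rw [← h.isInternal.submodule_iSup_eq_top]
  refine iSup_le fun g x hx => ?_
  by_cases hg : g = 0
  · exact hg ▸ hx
  · rw [h' g hg x hx]
    exact Submodule.zero_mem _

lemma zero_nondegenerate (h : IsGroupGrading 𝒮) (hn : IsSymmComp n) :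
    ∀ x ∈ 𝒮 0, (∀ y ∈ 𝒮 0, polar n x y = 0) → x = 0 := fun x hx h' =>
  h.eq_zero_of_polar hn hx (by rw [neg_zero]; exact h')

lemma zero_mul_mem (h : IsGroupGrading 𝒮) : ∀ x ∈ 𝒮 0, ∀ y ∈ 𝒮 0, x * y ∈ 𝒮 0 :=
  fun _ hx _ hy => by simpa using h.mul_mem hx hy

/-! ### Gradings for which the elements of a frame are homogeneous -/

lemma _root_.OkuboGradings.OkuboAlgebra.eq_sum {α β : k} (f : OkuboAlgebra α β) :
    f = ∑ r, OkuboAlgebra.coord r f • OkuboAlgebra.x α β r :=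
  ((Pi.basisFun k (Fin 8)).sum_repr f).symm.trans <| by simp; rfl

/-- If the elements of a basis are homogeneous, then each component is spanned by those of its
degree. -/
lemma map_eq_span (h : IsGroupGrading 𝒮) {α β : k} (φ : S ≃ₗ[k] OkuboAlgebra α β) {e : Fin 8 → S}
    (hφ : ∀ r, φ (e r) = OkuboAlgebra.x α β r) {deg : Fin 8 → G} (he : ∀ r, e r ∈ 𝒮 (deg r))
    (g : G) : (𝒮 g).map (φ : S →ₗ[k] OkuboAlgebra α β) =
      Submodule.span k {f | ∃ r, deg r = g ∧ f = OkuboAlgebra.x α β r} := by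
  refine le_antisymm ?_ ?_
  · rintro _ ⟨s, hs, rfl⟩
    have hsum : s = ∑ r, OkuboAlgebra.coord r (φ s) • e r := φ.injective <| by
      simp only [map_sum, map_smul, hφ]
      exact OkuboAlgebra.eq_sum _
    have hp : ∑ r with deg r = g, OkuboAlgebra.coord r (φ s) • e r ∈ 𝒮 g :=
      Submodule.sum_mem _ fun r hr => Submodule.smul_mem _ _ ((Finset.mem_filter.1 hr).2 ▸ he r)
    have hq : ∑ r with ¬ deg r = g, OkuboAlgebra.coord r (φ s) • e r = 0 := by
      refine h.eq_zero_of_mem_iSup (a := g) ?_ (Submodule.sum_mem _ fun r hr =>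
        Submodule.smul_mem _ _ (mem_iSup_ne (he r) (Finset.mem_filter.1 hr).2))
      have : ∑ r with ¬ deg r = g, OkuboAlgebra.coord r (φ s) • e r =
          s - ∑ r with deg r = g, OkuboAlgebra.coord r (φ s) • e r := by
        rw [eq_sub_iff_add_eq, add_comm, Finset.sum_filter_add_sum_filter_not]
        exact hsum.symm
      rw [this]
      exact Submodule.sub_mem _ hs hp
    have hs' : s = ∑ r with deg r = g, OkuboAlgebra.coord r (φ s) • e r := by
      rw [← add_zero (∑ r with deg r = g, _), ← hq, Finset.sum_filter_add_sum_filter_not]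
      exact hsum
    rw [LinearEquiv.coe_coe, hs', map_sum]
    refine Submodule.sum_mem _ fun r hr => ?_
    rw [map_smul, hφ]
    exact Submodule.smul_mem _ _ (Submodule.subset_span ⟨r, (Finset.mem_filter.1 hr).2, rfl⟩)
  · rw [Submodule.span_le]
    rintro _ ⟨r, rfl, rfl⟩
    exact ⟨e r, he r, hφ r⟩

variable [IsScalarTower k S S] [SMulCommClass k S S] {a a' b b' : S} {α β : k}

lemma vec_mem (h : IsGroupGrading 𝒮) (hf : IsOkuboFrame n a a' b b' α β)
    (F : ZMod 3 × ZMod 3 →+ G) (ha : a ∈ 𝒮 (F (1, 0))) (hb : b ∈ 𝒮 (F (0, 1))) (r : Fin 8) :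
    IsOkuboFrame.vec a a' b b' r ∈ 𝒮 (F (OkuboAlgebra.idx r)) := by
  have hmul : ∀ {p q s : ZMod 3 × ZMod 3} {x y : S}, x ∈ 𝒮 (F p) → y ∈ 𝒮 (F q) → p + q = s →
      x * y ∈ 𝒮 (F s) := fun hx hy hs => by
    rw [← hs, map_add]
    exact h.mul_mem hx hy
  have ha' : a' ∈ 𝒮 (F (-1, 0)) := by
    rw [hf.eq_a']
    exact Submodule.smul_mem _ _ (hmul ha ha rfl)
  have hb' : b' ∈ 𝒮 (F (0, -1)) := by
    rw [hf.eq_b']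
    exact Submodule.smul_mem _ _ (hmul hb hb rfl)
  fin_cases r
  exacts [ha, ha', hb, hb', hmul hb ha rfl, hmul hb' ha' rfl, hmul ha' hb rfl, hmul ha hb' rfl]

/-- The homogeneous elements of a frame determine the grading. -/
lemma map_eq_of_frame (h : IsGroupGrading 𝒮) (hf : IsOkuboFrame n a a' b b' α β)
    (hdim : Module.finrank k S = 8) (F : ZMod 3 × ZMod 3 →+ G) (ha : a ∈ 𝒮 (F (1, 0)))
    (hb : b ∈ 𝒮 (F (0, 1))) :
    Function.Surjective F ∧ ∃ φ : S ≃ₗ[k] OkuboAlgebra α β, IsOkuboIso n φ ∧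
      (∀ r, φ (IsOkuboFrame.vec a a' b b' r) = OkuboAlgebra.x α β r) ∧
      ∀ g, (𝒮 g).map (φ : S →ₗ[k] OkuboAlgebra α β) =
        Submodule.span k {f | ∃ r, F (OkuboAlgebra.idx r) = g ∧ f = OkuboAlgebra.x α β r} := by
  obtain ⟨φ, hiso, hφ⟩ := hf.exists_isOkuboIso hdim
  have hmap := h.map_eq_span φ hφ (h.vec_mem hf F ha hb)
  refine ⟨?_, φ, hiso, hφ, hmap⟩
  rw [← AddMonoidHom.range_eq_top, ← top_le_iff, ← h.closure_support, AddSubgroup.closure_le]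
  intro g hg
  by_contra hr
  refine hg ?_
  have hempty : {f | ∃ r, F (OkuboAlgebra.idx r) = g ∧ f = OkuboAlgebra.x α β r} = ∅ := by
    rw [Set.eq_empty_iff_forall_notMem]
    rintro _ ⟨r, hr', -⟩
    exact hr ⟨_, hr'⟩
  have := hmap g
  rw [hempty, Submodule.span_empty] at this
  exact Submodule.map_eq_bot_iff.1 this

end IsGroupGrading

lemma exists_zmod_hom {G : Type w} [AddGroup G] {a : G} (ha : a + a + a = 0) :
    ∃ f : ZMod 3 →+ G, f 1 = a := by
  have h3 : zmultiplesHom G a ((3 : ℕ) : ℤ) = 0 := by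
    rw [zmultiplesHom_apply, natCast_zsmul, succ_nsmul, two_nsmul, ha]
  refine ⟨ZMod.lift 3 ⟨zmultiplesHom G a, h3⟩, ?_⟩
  simpa using ZMod.lift_coe 3 ⟨zmultiplesHom G a, h3⟩ 1

lemma exists_zmod_prod_hom {G : Type w} [AddGroup G] {a b : G} (ha : a + a + a = 0)
    (hb : b + b + b = 0) (hab : a + b = b + a) :
    ∃ F : ZMod 3 × ZMod 3 →+ G, F (1, 0) = a ∧ F (0, 1) = b := by
  obtain ⟨f, hf⟩ := exists_zmod_hom ha
  obtain ⟨g, hg⟩ := exists_zmod_hom hb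
  have hsmul : ∀ (f : ZMod 3 →+ G) (i : ZMod 3), f i = i.val • f 1 := fun f i => by
    rw [← map_nsmul, nsmul_one, ZMod.natCast_zmod_val]
  refine ⟨AddMonoidHom.noncommCoprod f g fun i j => ?_, ?_, ?_⟩
  · rw [hsmul f, hsmul g, hf, hg]
    exact (show AddCommute a b from hab).nsmul_nsmul _ _
  · simp [hf]
  · simp [hg]

namespace IsGroupGrading

/-! ### Gradings with trivial neutral component -/

section ZeroEqBot

lemma norm_eq_zero_of_zero_eq_bot (h : IsGroupGrading 𝒮) (hn : IsSymmComp n) (h0 : 𝒮 0 = ⊥)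
    {a : G} {x : S} (hx : x ∈ 𝒮 a) : n x = 0 := by
  by_contra hnx
  have hx0 : x ≠ 0 := fun h' => hnx (by rw [h', QuadraticMap.map_zero])
  have h3 : n x • x ∈ 𝒮 (a + a + a) := by
    rw [← hn.mul_mul_left]
    exact h.mul_mem (h.mul_mem hx hx) hx
  by_cases haa : a + a = 0
  · have hxx := h.mul_mem hx hx
    rw [haa, h0, Submodule.mem_bot] at hxx
    have := hn.norm_mul x x
    rw [hxx, QuadraticMap.map_zero] at this
    exact mul_ne_zero hnx hnx this.symm
  · exact smul_ne_zero hnx hx0 (h.eq_zero_of_mem h3 ((𝒮 a).smul_mem _ hx) (by simpa using haa))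

lemma sq_ne_zero_of_zero_eq_bot (h : IsGroupGrading 𝒮) (hn : IsSymmComp n) (h0 : 𝒮 0 = ⊥)
    {a : G} {x : S} (hx : x ∈ 𝒮 a) (hx0 : x ≠ 0) : x * x ≠ 0 := by
  intro hxx
  obtain ⟨z, hz, hxz⟩ := h.exists_polar_eq_one hn hx hx0
  have h1 := hn.mul_mul_add x x z
  have hzx : z * x = 0 := by
    have := h.mul_mem hz hx
    rwa [neg_add_cancel, h0, Submodule.mem_bot] at this
  rw [hxz, hxx, hzx, zero_mul, zero_mul, one_smul, add_zero] at h1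
  exact hx0 h1.symm

variable [IsScalarTower k S S]

/-- If `S_0 = 0`, the cubic form is anisotropic on each component. -/
lemma polar_sq_ne_zero_of_zero_eq_bot (h : IsGroupGrading 𝒮) (hn : IsSymmComp n) (h0 : 𝒮 0 = ⊥)
    {a : G} {x : S} (hx : x ∈ 𝒮 a) (hx0 : x ≠ 0) : polar n x (x * x) ≠ 0 := by
  intro hg
  have h1 := hn.sq_mul_sq x
  rw [hg, h.norm_eq_zero_of_zero_eq_bot hn h0 hx, zero_smul, zero_smul, sub_zero] at h1
  exact h.sq_ne_zero_of_zero_eq_bot hn h0 (h.mul_mem hx hx)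
    (h.sq_ne_zero_of_zero_eq_bot hn h0 hx hx0) h1

lemma add_self_of_zero_eq_bot (h : IsGroupGrading 𝒮) (hn : IsSymmComp n) (h0 : 𝒮 0 = ⊥)
    {a : G} {x : S} (hx : x ∈ 𝒮 a) (hx0 : x ≠ 0) : a + a = -a := by
  by_contra hne
  refine h.polar_sq_ne_zero_of_zero_eq_bot hn h0 hx hx0 (h.polar_eq_zero hn hx (h.mul_mem hx hx) ?_)
  exact fun h' => hne (eq_neg_of_add_eq_zero_right h')

/-- If `S_0 = 0` and `w`, of degree opposite to that of `x`, is orthogonal to `x`, then `w = 0`: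
otherwise `x + x * x` and `w * w + w` would be zero divisors that are not isotropic. -/
lemma eq_zero_of_polar_of_zero_eq_bot (h : IsGroupGrading 𝒮) (hn : IsSymmComp n) (h0 : 𝒮 0 = ⊥)
    {a : G} {x w : S} (hx : x ∈ 𝒮 a) (hx0 : x ≠ 0) (hw : w ∈ 𝒮 (-a)) (hxw : polar n x w = 0) :
    w = 0 := by
  by_contra hw0
  have haa := h.add_self_of_zero_eq_bot hn h0 hx hx0
  have haa' : -a + -a = a := by rw [← neg_add_rev, haa, neg_neg]
  have hz : ∀ {b : G} {y z : S}, y ∈ 𝒮 b → z ∈ 𝒮 (-b) → y * z = 0 := fun hy hz => by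
    have := h.mul_mem hy hz
    rwa [add_neg_cancel, h0, Submodule.mem_bot] at this
  have hv : x * x ∈ 𝒮 (-a) := haa ▸ h.mul_mem hx hx
  have hu : w * w ∈ 𝒮 a := haa' ▸ h.mul_mem hw hw
  have hnorm : ∀ {b : G} {y : S}, y ∈ 𝒮 b → n y = 0 := fun hy =>
    h.norm_eq_zero_of_zero_eq_bot hn h0 hy
  have hg := h.polar_sq_ne_zero_of_zero_eq_bot hn h0 hx hx0
  have hg' := h.polar_sq_ne_zero_of_zero_eq_bot hn h0 hw hw0
  have hvw : (x * x) * w = 0 := by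
    rw [hn.mul_mul_eq, hxw, hz hw (by rwa [neg_neg]), zero_smul, zero_mul, sub_zero]
  have hxu : x * (w * w) = 0 := by
    have h1 := hn.mul_mul_eq (x * x) (x * x) (w * w)
    rw [← hn.polar_mul, hvw, QuadraticMap.polar_zero_left, hz hu hv, zero_smul, zero_mul, sub_zero,
      hn.sq_mul_sq, hnorm hx, zero_smul, sub_zero, smul_mul_assoc] at h1
    exact (smul_eq_zero.1 h1).resolve_left hg
  have hprod : (x + x * x) * (w * w + w) = 0 := by
    rw [add_mul, mul_add, mul_add, hxu, hz hx hw, hz hv (by rwa [neg_neg]), hvw]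
    simp
  have h1 := hn.norm_mul (x + x * x) (w * w + w)
  rw [hprod, QuadraticMap.map_zero, norm_add, norm_add, hnorm hx, hnorm hv, hnorm hw, hnorm hu,
    zero_add, zero_add, zero_add, QuadraticMap.polar_comm n (w * w)] at h1
  exact mul_ne_zero hg hg' h1.symm

lemma exists_eq_smul_of_zero_eq_bot (h : IsGroupGrading 𝒮) (hn : IsSymmComp n) (h0 : 𝒮 0 = ⊥)
    {a : G} {x y : S} (hx : x ∈ 𝒮 a) (hx0 : x ≠ 0) (hy : y ∈ 𝒮 a) : ∃ c : k, y = c • x := by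
  have haa := h.add_self_of_zero_eq_bot hn h0 hx hx0
  have hv : x * x ∈ 𝒮 (-a) := haa ▸ h.mul_mem hx hx
  have hg := h.polar_sq_ne_zero_of_zero_eq_bot hn h0 hx hx0
  rw [QuadraticMap.polar_comm] at hg
  refine ⟨polar n (x * x) y / polar n (x * x) x, sub_eq_zero.1 ?_⟩
  refine h.eq_zero_of_polar_of_zero_eq_bot hn h0 hv (h.sq_ne_zero_of_zero_eq_bot hn h0 hx hx0)
    (by rw [neg_neg]; exact Submodule.sub_mem _ hy (Submodule.smul_mem _ _ hx)) ?_
  rw [QuadraticMap.polar_sub_right, QuadraticMap.polar_smul_right, smul_eq_mul,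
    div_mul_cancel₀ _ hg, sub_self]

lemma exists_ne_of_zero_eq_bot (h : IsGroupGrading 𝒮) (hn : IsSymmComp n) (h0 : 𝒮 0 = ⊥)
    (hdim : Module.finrank k S = 8) {a : G} {x : S} (hx : x ∈ 𝒮 a) (hx0 : x ≠ 0) :
    ∃ b, b ≠ a ∧ b ≠ -a ∧ ∃ y ∈ 𝒮 b, y ≠ 0 := by
  by_contra! h'
  have haa := h.add_self_of_zero_eq_bot hn h0 hx hx0
  have hv : x * x ∈ 𝒮 (-a) := haa ▸ h.mul_mem hx hx
  have hv0 := h.sq_ne_zero_of_zero_eq_bot hn h0 hx hx0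
  have htop : Submodule.span k (Set.range ![x, x * x]) = ⊤ := by
    rw [← top_le_iff, ← h.isInternal.submodule_iSup_eq_top]
    refine iSup_le fun g y hy => ?_
    by_cases hga : g = a
    · obtain ⟨c, rfl⟩ := h.exists_eq_smul_of_zero_eq_bot hn h0 hx hx0 (hga ▸ hy)
      exact Submodule.smul_mem _ _ (Submodule.subset_span ⟨0, rfl⟩)
    · by_cases hga' : g = -a
      · obtain ⟨c, rfl⟩ := h.exists_eq_smul_of_zero_eq_bot hn h0 hv hv0 (hga' ▸ hy)
        exact Submodule.smul_mem _ _ (Submodule.subset_span ⟨1, rfl⟩)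
      · rw [h' g hga hga' y hy]
        exact Submodule.zero_mem _
  have h1 := finrank_range_le_card (R := k) ![x, x * x]
  rw [Set.finrank, htop, finrank_top, hdim, Fintype.card_fin] at h1
  omega

lemma not_mul_eq_zero_of_zero_eq_bot (h : IsGroupGrading 𝒮) (hn : IsSymmComp n) (h0 : 𝒮 0 = ⊥)
    {a b : G} {x y : S} (hx : x ∈ 𝒮 a) (hx0 : x ≠ 0) (hy : y ∈ 𝒮 b) (hy0 : y ≠ 0)
    (hab : b ≠ -a) (hxy : x * y = 0) (hyx : y * x = 0) : False := by
  have haa := h.add_self_of_zero_eq_bot hn h0 hx hx0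
  have hv : x * x ∈ 𝒮 (-a) := haa ▸ h.mul_mem hx hx
  have hp : polar n x y = 0 :=
    h.polar_eq_zero hn hx hy fun h' => hab (eq_neg_of_add_eq_zero_right h')
  have hvy : (x * x) * y = 0 := by
    rw [hn.mul_mul_eq, hp, hyx, zero_smul, zero_mul, sub_zero]
  have hnorm : n (x + x * x) ≠ 0 := by
    rw [norm_add, h.norm_eq_zero_of_zero_eq_bot hn h0 hx, h.norm_eq_zero_of_zero_eq_bot hn h0 hv,
      zero_add, zero_add]
    exact h.polar_sq_ne_zero_of_zero_eq_bot hn h0 hx hx0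
  have h1 := hn.mul_mul_left (x + x * x) y
  rw [add_mul x, hxy, hvy, add_zero, zero_mul] at h1
  exact hy0 ((smul_eq_zero.1 h1.symm).resolve_left hnorm)

variable [SMulCommClass k S S]

/-- If `S_0 = 0`, then homogeneous elements of degrees `a` and `b ≠ ± a` multiply to zero in at least
one order; `not_mul_eq_zero_of_zero_eq_bot` excludes that they do so in both. -/
lemma mul_eq_zero_or_of_zero_eq_bot (h : IsGroupGrading 𝒮) (hn : IsSymmComp n) (h0 : 𝒮 0 = ⊥)
    {a b : G} {x y : S} (hx : x ∈ 𝒮 a) (hx0 : x ≠ 0) (hy : y ∈ 𝒮 b) (hy0 : y ≠ 0)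
    (hab : b ≠ a) (hab' : b ≠ -a) : x * y = 0 ∨ y * x = 0 := by
  by_contra! hne
  have haa := h.add_self_of_zero_eq_bot hn h0 hx hx0
  have hv : x * x ∈ 𝒮 (-a) := haa ▸ h.mul_mem hx hx
  have hp : polar n x y = 0 :=
    h.polar_eq_zero hn hx hy fun h' => hab' (eq_neg_of_add_eq_zero_right h')
  have hnx := h.norm_eq_zero_of_zero_eq_bot hn h0 hx
  have hyx := h.mul_mem hy hx
  have hxy := h.mul_mem hx hy
  rw [← h.add_comm_of_mem hn hx hx0 hy hy0] at hyx
  obtain ⟨c, hc⟩ := h.exists_eq_smul_of_zero_eq_bot hn h0 hxy hne.1 hyx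
  obtain ⟨d, hd⟩ := h.exists_eq_smul_of_zero_eq_bot hn h0 hyx hne.2 hxy
  refine h.not_mul_eq_zero_of_zero_eq_bot hn h0 hv (h.sq_ne_zero_of_zero_eq_bot hn h0 hx hx0) hy
    hy0 (by rwa [neg_neg]) ?_ ?_
  · rw [hn.mul_mul_eq, hp, hc, smul_mul_assoc, hn.mul_mul_left, hnx]
    simp
  · rw [hn.mul_mul_eq', QuadraticMap.polar_comm, hp, hd, mul_smul_comm, hn.mul_mul_right, hnx]
    simp

/-- A grading with `S_0 = 0` is the standard `ℤ₃²`-grading. -/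
theorem standardZ3SquaredCase (h : IsGroupGrading 𝒮) (hn : IsSymmComp n)
    (hdim : Module.finrank k S = 8) (h0 : 𝒮 0 = ⊥) (h1 : 𝒮 0 ≠ ⊤) : StandardZ3SquaredCase n h := by
  have key : ∀ {a b : G} {x y : S}, x ∈ 𝒮 a → x ≠ 0 → y ∈ 𝒮 b → y ≠ 0 → b ≠ -a → x * y = 0 →
      StandardZ3SquaredCase n h := by
    intro a b x y hx hx0 hy hy0 hab hxy
    have haa := h.add_self_of_zero_eq_bot hn h0 hx hx0
    have hbb := h.add_self_of_zero_eq_bot hn h0 hy hy0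
    obtain ⟨F, hFa, hFb⟩ := exists_zmod_prod_hom (by rw [haa, neg_add_cancel])
      (by rw [hbb, neg_add_cancel]) (h.add_comm_of_mem hn hx hx0 hy hy0)
    have hf := hn.isOkuboFrame (α := -polar n x (x * x)) (β := -polar n y (y * y))
      (neg_ne_zero.2 (h.polar_sq_ne_zero_of_zero_eq_bot hn h0 hx hx0))
      (neg_ne_zero.2 (h.polar_sq_ne_zero_of_zero_eq_bot hn h0 hy hy0))
      (h.norm_eq_zero_of_zero_eq_bot hn h0 hx) (h.norm_eq_zero_of_zero_eq_bot hn h0 hy)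
      (neg_neg _).symm (neg_neg _).symm
      (h.polar_eq_zero hn hx hy fun h' => hab (eq_neg_of_add_eq_zero_right h')) hxy
    obtain ⟨hsurj, φ, hiso, -, hmap⟩ := h.map_eq_of_frame hf hdim F (by rwa [hFa]) (by rwa [hFb])
    have hinj : Function.Injective F := by
      rw [injective_iff_map_eq_zero]
      intro p hp
      by_contra hp0
      -- A nonzero element of the kernel is the degree of one of the basis elements.
      obtain ⟨r, rfl⟩ : ∃ r, OkuboAlgebra.idx r = p := by
        revert hp0
        clear hp
        revert p
        decide
      have hr : OkuboAlgebra.x _ _ r ∈ (𝒮 0).map φ.toLinearMap := by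
        rw [hmap]
        exact Submodule.subset_span ⟨r, hp, rfl⟩
      rw [h0, Submodule.map_bot, Submodule.mem_bot] at hr
      have := congrArg (OkuboAlgebra.coord r) hr
      rw [OkuboAlgebra.coord_x, if_pos rfl, map_zero] at this
      exact one_ne_zero this
    let ψ := (AddEquiv.ofBijective F ⟨hinj, hsurj⟩).symm
    refine ⟨h0, ψ, _, _, φ, hf.left_ne_zero, hf.right_ne_zero, hiso, fun g => ?_⟩
    have hψ : ∀ p, F p = g ↔ p = ψ g := fun p =>
      (AddEquiv.eq_symm_apply (AddEquiv.ofBijective F ⟨hinj, hsurj⟩)).symm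
    rw [hmap, OkuboAlgebra.standardGrading₂]
    simp only [hψ]
  obtain ⟨a, -, x, hx, hx0⟩ := h.exists_ne_zero h1
  obtain ⟨b, hba, hba', y, hy, hy0⟩ := h.exists_ne_of_zero_eq_bot hn h0 hdim hx hx0
  rcases h.mul_eq_zero_or_of_zero_eq_bot hn h0 hx hx0 hy hy0 hba hba' with hxy | hyx
  · exact key hx hx0 hy hy0 hba' hxy
  · exact key hy hy0 hx hx0 (fun h' => hba' (by rw [h', neg_neg])) hyx

end ZeroEqBot

end IsGroupGrading

/-! ### Gradings whose neutral component is a plane without idempotents -/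


lemma linearIndependent_of_cube {V : Type v} [AddCommGroup V] [Module k V] (T : V →ₗ[k] V) {c : k}
    {m : V} (hc : ∀ s : k, s ^ 3 ≠ c) (hm : m ≠ 0) (hT : T (T (T m)) = c • m) :
    LinearIndependent k ![m, T m, T (T m)] := by
  open Polynomial in
  rw [Fintype.linearIndependent_iff]
  intro g hg
  simp only [Fin.sum_univ_three, Matrix.cons_val_zero, Matrix.cons_val_one, Matrix.cons_val] at hg
  have hirr : Irreducible (X ^ 3 - C c : k[X]) :=
    X_pow_sub_C_irreducible_of_prime Nat.prime_three hc
  let p : k[X] := C (g 0) + C (g 1) * X + C (g 2) * X ^ 2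
  have hp : aeval T p m = 0 := by
    rw [← hg]
    simp [p, pow_two, Algebra.algebraMap_eq_smul_one]
  have hq : aeval T (X ^ 3 - C c : k[X]) m = 0 := by
    simp [pow_succ, Algebra.algebraMap_eq_smul_one, hT]
  have hpdeg : p.natDegree ≤ 2 := by
    simp only [p]
    compute_degree
  have hqdeg : (X ^ 3 - C c : k[X]).natDegree = 3 := natDegree_X_pow_sub_C
  have hp0 : p = 0 := by
    by_contra hp0
    have hnd : ¬ (X ^ 3 - C c : k[X]) ∣ p := fun hd => by
      have := natDegree_le_of_dvd hd hp0
      omega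
    obtain ⟨r, s, hrs⟩ := (hirr.coprime_iff_not_dvd.2 hnd)
    refine hm ?_
    have : aeval T (r * (X ^ 3 - C c) + s * p) m = m := by rw [hrs]; simp
    rw [← this, map_add, map_mul, map_mul, LinearMap.add_apply, Module.End.mul_apply,
      Module.End.mul_apply, hp, hq, map_zero, map_zero, add_zero]
  intro i
  have h0 := congrArg (fun q => coeff q 0) hp0
  have h1 := congrArg (fun q => coeff q 1) hp0
  have h2 := congrArg (fun q => coeff q 2) hp0
  simp [p, coeff_X, coeff_C] at h0 h1 h2
  fin_cases i <;> assumption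

/-- Elements `x, x'` of a plane `W` (in the application, `S_0`) that behave like the elements
`x_{1,0}, x_{-1,0}` of `O_{α,β}`, where `α` is not a cube. -/
structure IsZeroFrame (n : QuadraticForm k S) (W : Submodule k S) (x x' : S) (α : k) : Prop where
  isSymmComp : IsSymmComp n
  ne_zero : α ≠ 0
  not_cube : ∀ s : k, s ^ 3 ≠ α
  mem : x ∈ W
  mem' : x' ∈ W
  norm_x : n x = 0
  norm_x' : n x' = 0
  polar_eq : polar n x x' = 1
  sq_x : x * x = -α • x'
  sq_x' : x' * x' = -α⁻¹ • x
  exists_eq : ∀ z ∈ W, ∃ c d : k, z = c • x + d • x'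

namespace IsZeroFrame

variable [IsScalarTower k S S] [SMulCommClass k S S] {W : Submodule k S} {x x' : S} {α : k}

lemma swap (h : IsZeroFrame n W x x' α) : IsZeroFrame n W x' x α⁻¹ where
  isSymmComp := h.isSymmComp
  ne_zero := inv_ne_zero h.ne_zero
  not_cube s hs := h.not_cube s⁻¹ (by rw [inv_pow, hs, inv_inv])
  mem := h.mem'
  mem' := h.mem
  norm_x := h.norm_x'
  norm_x' := h.norm_x
  polar_eq := by rw [QuadraticMap.polar_comm, h.polar_eq]
  sq_x := h.sq_x'
  sq_x' := by rw [inv_inv, h.sq_x]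
  exists_eq z hz := by
    obtain ⟨c, d, hcd⟩ := h.exists_eq z hz
    exact ⟨d, c, by rw [hcd, add_comm]⟩

lemma mul_mul_eq_zero (h : IsZeroFrame n W x x' α) {m : S} (hm : polar n x' m = 0) :
    x' * (x * m) = 0 := by
  have h0 : m * (x * x') = 0 := by
    have : x * x' = 0 := by
      have h1 := h.isSymmComp.mul_mul_right x x
      rw [h.sq_x, h.norm_x, zero_smul, mul_smul_comm] at h1
      exact (smul_eq_zero.1 h1).resolve_left (neg_ne_zero.2 h.ne_zero)
    rw [this, mul_zero]
  rw [h.isSymmComp.mul_mul_eq', hm, h0, zero_smul, sub_zero]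

/-- On the kernel of the multiplication by `x`, the cube of the multiplication by `x'` is the
scalar `α⁻¹`, which is not a cube. -/
lemma mul_mul_mul_eq (h : IsZeroFrame n W x x' α) {m : S} (hm : polar n x m = 0)
    (hm' : polar n x' m = 0) (hxm : x * m = 0) : x' * (x' * (x' * m)) = α⁻¹ • m := by
  have hmx' : m * x' = 0 := by
    have h1 := h.isSymmComp.mul_mul_eq' x x m
    rw [hxm, mul_zero, hm, zero_smul, zero_sub, h.sq_x, mul_smul_comm, neg_smul, neg_neg] at h1
    exact (smul_eq_zero.1 h1.symm).resolve_left h.ne_zero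
  rw [h.isSymmComp.mul_mul_eq' x' x' m, hm', zero_smul, zero_sub, h.sq_x', mul_smul_comm, neg_smul,
    neg_neg, mul_smul_comm, h.isSymmComp.mul_mul_eq' x' m x, hmx', mul_zero, sub_zero,
    QuadraticMap.polar_comm, h.polar_eq, one_smul]

lemma linearIndependent (h : IsZeroFrame n W x x' α) {m : S} (hm : polar n x m = 0)
    (hm' : polar n x' m = 0) (hxm : x * m = 0) (hm0 : m ≠ 0) :
    LinearIndependent k ![m, x' * m, x' * (x' * m)] :=
  linearIndependent_of_cube (LinearMap.mulLeft k x') h.swap.not_cube hm0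
    (h.mul_mul_mul_eq hm hm' hxm)

end IsZeroFrame

/-- In a plane, an isotropic vector and a vector that is not orthogonal to it form a basis. -/
lemma exists_eq_of_finrank_eq_two {W : Submodule k S} (h2 : Module.finrank k W = 2) {x y : S}
    (hx : x ∈ W) (hy : y ∈ W) (hnx : n x = 0) (hxy : polar n x y ≠ 0) (z : S) (hz : z ∈ W) :
    ∃ c d : k, z = c • x + d • y := by
  have hfin : Module.Finite k W := Module.finite_of_finrank_pos (by omega)
  have hli : LinearIndependent k ![x, y] := by
    rw [LinearIndependent.pair_iff]
    intro c d hcd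
    have h1 := congrArg (polar n x) hcd
    rw [QuadraticMap.polar_add_right, QuadraticMap.polar_smul_right, QuadraticMap.polar_smul_right,
      polar_self_eq, hnx, mul_zero, smul_zero, zero_add, QuadraticMap.polar_zero_right,
      smul_eq_mul] at h1
    have hd := (mul_eq_zero.1 h1).resolve_right hxy
    rw [hd, zero_smul, add_zero] at hcd
    refine ⟨(smul_eq_zero.1 hcd).resolve_right fun h0 => hxy ?_, hd⟩
    rw [h0, QuadraticMap.polar_zero_left]
  have hspan : Submodule.span k (Set.range ![x, y]) = W := by
    refine Submodule.eq_of_le_of_finrank_le ?_ ?_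
    · rw [Submodule.span_le]
      rintro _ ⟨i, rfl⟩
      fin_cases i
      exacts [hx, hy]
    · rw [h2, finrank_span_eq_card hli, Fintype.card_fin]
  rw [← hspan, Submodule.mem_span_range_iff_exists_fun] at hz
  obtain ⟨c, rfl⟩ := hz
  exact ⟨c 0, c 1, by simp⟩

/-- An isotropic vector of a nondegenerate plane closed under multiplication is the first element of
a frame of the plane, unless the plane contains an idempotent. -/
lemma IsSymmComp.isZeroFrame [IsScalarTower k S S] [SMulCommClass k S S] (hn : IsSymmComp n)
    {W : Submodule k S} (hmul : ∀ x ∈ W, ∀ y ∈ W, x * y ∈ W)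
    (hnd : ∀ x ∈ W, (∀ y ∈ W, polar n x y = 0) → x = 0) (h2 : Module.finrank k W = 2)
    (hid : ∀ e ∈ W, e * e = e → e = 0) {x : S} (hx : x ∈ W) (hx0 : x ≠ 0) (hnx : n x = 0) :
    IsZeroFrame n W x (-(-polar n x (x * x))⁻¹ • (x * x)) (-polar n x (x * x)) := by
  have hxx := hmul x hx x hx
  have hpx : polar n x x = 0 := by rw [polar_self_eq, hnx, mul_zero]
  have hg : polar n x (x * x) ≠ 0 := by
    intro hg
    obtain ⟨y, hy, hxy⟩ : ∃ y ∈ W, polar n x y ≠ 0 := by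
      by_contra! h'
      exact hx0 (hnd x hx h')
    have hspan := exists_eq_of_finrank_eq_two h2 hx hy hnx hxy
    have hline : ∀ z ∈ W, polar n x z = 0 → ∃ c : k, z = c • x := by
      intro z hz hxz
      obtain ⟨c, d, rfl⟩ := hspan z hz
      rw [QuadraticMap.polar_add_right, QuadraticMap.polar_smul_right,
        QuadraticMap.polar_smul_right, hpx, smul_zero, zero_add, smul_eq_mul] at hxz
      refine ⟨c, ?_⟩
      rw [(mul_eq_zero.1 hxz).resolve_right hxy, zero_smul, add_zero]
    obtain ⟨c, hc⟩ := hline _ hxx hg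
    have hsq : x * x = 0 := by
      have h1 := hn.mul_mul_left x x
      rw [hc, smul_mul_assoc, hc, hnx, zero_smul, smul_smul] at h1
      rcases smul_eq_zero.1 h1 with h0 | h0
      · rw [hc, mul_self_eq_zero.1 h0, zero_smul]
      · exact absurd h0 hx0
    obtain ⟨d, hd⟩ := hline _ (hmul y hy x hx) (by
      rw [QuadraticMap.polar_comm, hn.polar_mul, hsq, QuadraticMap.polar_zero_right])
    have h1 := hn.mul_mul_add x x y
    rw [hsq, zero_mul, zero_add, hd, smul_mul_assoc, hsq, smul_zero] at h1
    exact (smul_ne_zero hxy hx0) h1.symm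
  set α := -polar n x (x * x) with hα
  have hα0 : α ≠ 0 := neg_ne_zero.2 hg
  have hgα : polar n x (x * x) = -α := by rw [hα, neg_neg]
  have hsq : x * x = -α • (-α⁻¹ • (x * x)) := by
    rw [smul_smul, neg_mul_neg, mul_inv_cancel₀ hα0, one_smul]
  have hsq' : (-α⁻¹ • (x * x)) * (-α⁻¹ • (x * x)) = -α⁻¹ • x := by
    rw [smul_mul_smul_comm, hn.sq_mul_sq, hnx, zero_smul, sub_zero, hgα, smul_smul]
    congr 1
    field_simp
  have hpx' : polar n x (-α⁻¹ • (x * x)) = 1 := by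
    rw [QuadraticMap.polar_smul_right, hgα, smul_eq_mul, neg_mul_neg, inv_mul_cancel₀ hα0]
  have hx' := W.smul_mem (-α⁻¹) hxx
  have hnx' : n (-α⁻¹ • (x * x)) = 0 := by rw [norm_smul, hn.norm_mul, hnx, mul_zero, mul_zero]
  have hxx' : x * (-α⁻¹ • (x * x)) = 0 := by
    rw [mul_smul_comm, hn.mul_mul_right, hnx, zero_smul, smul_zero]
  have hx'x : (-α⁻¹ • (x * x)) * x = 0 := by
    rw [smul_mul_assoc, hn.mul_mul_left, hnx, zero_smul, smul_zero]
  refine ⟨hn, hα0, fun s hs => ?_, hx, hx', hnx, hnx', hpx', hsq, hsq',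
    exists_eq_of_finrank_eq_two h2 hx hx' hnx (by rw [hpx']; exact one_ne_zero)⟩
  -- If `α = s³`, then `-s⁻¹ x - s x'` is an idempotent.
  generalize -α⁻¹ • (x * x) = x' at *
  have hs0 : s ≠ 0 := fun h0 => hα0 (by rw [← hs, h0, zero_pow three_ne_zero])
  have he := hid (-s⁻¹ • x + -s • x') (W.add_mem (W.smul_mem _ hx) (W.smul_mem _ hx')) (by
    simp only [add_mul, mul_add, smul_mul_smul_comm, hxx', hx'x, hsq', hsq, smul_zero, add_zero,
      zero_add, smul_smul, ← hs]
    rw [add_comm]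
    congr 2 <;> field_simp)
  have h1 := congrArg (polar n x) he
  rw [QuadraticMap.polar_add_right, QuadraticMap.polar_smul_right, QuadraticMap.polar_smul_right,
    hpx, hpx', QuadraticMap.polar_zero_right, smul_zero, zero_add, smul_eq_mul, mul_one] at h1
  exact hs0 (neg_eq_zero.1 h1)

namespace IsGroupGrading

variable [IsScalarTower k S S] [SMulCommClass k S S]

/-- A homogeneous vector of nonzero degree that is not isotropic provides an idempotent
in `S_0`. -/
lemma norm_eq_zero_of_forall_idem (h : IsGroupGrading 𝒮) (hn : IsSymmComp n)
    (hid : ∀ e ∈ 𝒮 0, e * e = e → e = 0) {a : G} (ha : a ≠ 0) {u : S} (hu : u ∈ 𝒮 a) :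
    n u = 0 := by
  by_contra hnu
  have hu0 : u ≠ 0 := fun h0 => hnu (by rw [h0, QuadraticMap.map_zero])
  have huu := h.mul_mem hu hu
  have haa : a + a = 0 := by
    by_contra haa
    refine smul_ne_zero hnu hu0 (h.eq_zero_of_mem (a := a + a + a) (b := a) ?_
      ((𝒮 a).smul_mem _ hu) (by simpa using haa))
    rw [← hn.mul_mul_left]
    exact h.mul_mem huu hu
  obtain ⟨he, he0⟩ := hn.isIdempotent_of_polar_sq_eq_zero hnu
    (h.polar_eq_zero hn hu huu (by rw [haa, add_zero]; exact ha))
  exact he0 (hid _ (Submodule.smul_mem _ _ (haa ▸ huu)) he)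

lemma exists_isotropic (h : IsGroupGrading 𝒮) (hn : IsSymmComp n) (h0 : 𝒮 0 ≠ ⊥)
    (hid : ∀ e ∈ 𝒮 0, e * e = e → e = 0) {a : G} (ha : a ≠ 0) {u : S} (hu : u ∈ 𝒮 a)
    (hu0 : u ≠ 0) : ∃ x ∈ 𝒮 0, x ≠ 0 ∧ n x = 0 := by
  obtain ⟨p, hp, hnp⟩ := exists_norm_ne_zero (h.zero_nondegenerate hn) h0
  have hup : u * p ∈ 𝒮 a := by simpa using h.mul_mem hu hp
  obtain ⟨v, hv, huv⟩ := h.exists_polar_eq_one hn hup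
    fun h' => hu0 (hn.eq_zero_of_mul_eq_zero hnp h')
  refine ⟨v * u, by simpa using h.mul_mem hv hu, fun h' => ?_, ?_⟩
  · rw [QuadraticMap.polar_comm, ← hn.polar_mul, h', QuadraticMap.polar_zero_left] at huv
    exact zero_ne_one huv
  · rw [hn.norm_mul, h.norm_eq_zero_of_forall_idem hn hid ha hu, mul_zero]

section ZeroFrame

variable {x x' : S} {α : k}

/-- Either `x` or `x'` annihilates a nonzero vector of a given component. -/
lemma exists_mul_eq_zero (h : IsGroupGrading 𝒮) (hf : IsZeroFrame n (𝒮 0) x x' α) {a : G}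
    (ha : a ≠ 0) {m : S} (hm : m ∈ 𝒮 a) (hm0 : m ≠ 0) :
    ∃ (y y' : S) (γ : k), IsZeroFrame n (𝒮 0) y y' γ ∧ ∃ u ∈ 𝒮 a, u ≠ 0 ∧ y * u = 0 := by
  by_cases hxm : x * m = 0
  · exact ⟨x, x', α, hf, m, hm, hm0, hxm⟩
  · refine ⟨x', x, α⁻¹, hf.swap, x * m, by simpa using h.mul_mem hf.mem hm, hxm, ?_⟩
    exact hf.mul_mul_eq_zero (h.polar_eq_zero hf.isSymmComp hf.mem' hm (by rwa [zero_add]))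

lemma linearIndependent_of_mul_eq_zero (h : IsGroupGrading 𝒮) (hf : IsZeroFrame n (𝒮 0) x x' α)
    {a : G} (ha : a ≠ 0) {m : S} (hm : m ∈ 𝒮 a) (hm0 : m ≠ 0) (hxm : x * m = 0) :
    LinearIndependent k ![m, x' * m, x' * (x' * m)] :=
  hf.linearIndependent (h.polar_eq_zero hf.isSymmComp hf.mem hm (by rwa [zero_add]))
    (h.polar_eq_zero hf.isSymmComp hf.mem' hm (by rwa [zero_add])) hxm hm0

lemma span_le (h : IsGroupGrading 𝒮) (hf : IsZeroFrame n (𝒮 0) x x' α) {a : G} {m : S}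
    (hm : m ∈ 𝒮 a) : Submodule.span k (Set.range ![m, x' * m, x' * (x' * m)]) ≤ 𝒮 a := by
  have hx' : ∀ {z}, z ∈ 𝒮 a → x' * z ∈ 𝒮 a := fun hz => by simpa using h.mul_mem hf.mem' hz
  rw [Submodule.span_le]
  rintro _ ⟨i, rfl⟩
  fin_cases i
  exacts [hm, hx' hm, hx' (hx' hm)]

lemma three_le_finrank (h : IsGroupGrading 𝒮) (hf : IsZeroFrame n (𝒮 0) x x' α)
    (hdim : Module.finrank k S = 8) {a : G} (ha : a ≠ 0) {m : S} (hm : m ∈ 𝒮 a) (hm0 : m ≠ 0) :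
    3 ≤ Module.finrank k (𝒮 a) := by
  have hfin : Module.Finite k S := Module.finite_of_finrank_pos (by omega)
  obtain ⟨y, y', γ, hf', u, hu, hu0, hyu⟩ := h.exists_mul_eq_zero hf ha hm hm0
  have h1 := finrank_span_eq_card (h.linearIndependent_of_mul_eq_zero hf' ha hu hu0 hyu)
  rw [Fintype.card_fin] at h1
  exact h1.ge.trans (Submodule.finrank_mono (h.span_le hf' hu))

end ZeroFrame

lemma finrank_finset_sup (h : IsGroupGrading 𝒮) [Module.Finite k S] (s : Finset G) :
    Module.finrank k (s.sup 𝒮 : Submodule k S) = ∑ g ∈ s, Module.finrank k (𝒮 g) := by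
  induction s using Finset.induction_on with
  | empty => simp
  | insert a s ha ih =>
    have hle : s.sup 𝒮 ≤ ⨆ g, ⨆ (_ : g ≠ a), 𝒮 g := Finset.sup_le fun g hg x hx =>
      mem_iSup_ne hx fun h' => ha (h' ▸ hg)
    have hdisj := (h.isInternal.submodule_iSupIndep a).mono_right hle
    have := Submodule.finrank_sup_add_finrank_inf_eq (𝒮 a) (s.sup 𝒮)
    rw [hdisj.eq_bot, finrank_bot, add_zero] at this
    rw [Finset.sup_insert, Finset.sum_insert ha, this, ih]

lemma sum_finrank_le (h : IsGroupGrading 𝒮) [Module.Finite k S] (s : Finset G) :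
    ∑ g ∈ s, Module.finrank k (𝒮 g) ≤ Module.finrank k S :=
  (h.finrank_finset_sup s).ge.trans (Submodule.finrank_le _)

section ZeroFrame

variable {x x' : S} {α : k}

/-- If `x` annihilates a nonzero vector `u` of degree `a`, then `x` and `u` generate the algebra.
The point is that `n(u, u * u) ≠ 0`: the square of `u` is not zero, since otherwise `u` would be an
eigenvector of the multiplication by `x'`, and it is orthogonal to `x' * u` and `x' * (x' * u)`,
which together with `u` span the component of degree `a`. -/
lemma polar_sq_ne_zero_of_mul_eq_zero (h : IsGroupGrading 𝒮) (hf : IsZeroFrame n (𝒮 0) x x' α)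
    (hdim : Module.finrank k S = 8) (h2 : Module.finrank k (𝒮 0) = 2)
    (hid : ∀ e ∈ 𝒮 0, e * e = e → e = 0) {a : G} (ha : a ≠ 0) {u : S} (hu : u ∈ 𝒮 a)
    (hu0 : u ≠ 0) (hxu : x * u = 0) : polar n u (u * u) ≠ 0 := by
  intro hg
  have hfin : Module.Finite k S := Module.finite_of_finrank_pos (by omega)
  have hn := hf.isSymmComp
  have hnorm : ∀ {z}, z ∈ 𝒮 a → n z = 0 := fun hz => h.norm_eq_zero_of_forall_idem hn hid ha hz
  have horth : ∀ {z w}, z ∈ 𝒮 a → w ∈ 𝒮 a → polar n z w = 0 := fun hz hw => by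
    rw [polar, hnorm (Submodule.add_mem _ hz hw), hnorm hz, hnorm hw, sub_zero, sub_zero]
  obtain ⟨z, hz, huz⟩ := h.exists_polar_eq_one hn hu hu0
  have hz0 : z ≠ 0 := fun h0 => by
    rw [h0, QuadraticMap.polar_zero_right] at huz
    exact zero_ne_one huz
  have haa : a ≠ -a := fun h' => by
    rw [← h'] at hz
    rw [horth hu hz] at huz
    exact zero_ne_one huz
  have ha' : -a ≠ 0 := neg_ne_zero.2 ha
  have e1 := h.three_le_finrank hf hdim ha hu hu0
  have e2 := h.three_le_finrank hf hdim ha' hz hz0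
  have e3 := h.sum_finrank_le {0, a, -a}
  have hm0 : (0 : G) ∉ ({a, -a} : Finset G) := by simp [ha.symm, ha'.symm]
  rw [Finset.sum_insert hm0, Finset.sum_pair haa] at e3
  have hspan : Submodule.span k (Set.range ![u, x' * u, x' * (x' * u)]) = 𝒮 a := by
    refine Submodule.eq_of_le_of_finrank_le (h.span_le hf hu) ?_
    rw [finrank_span_eq_card (h.linearIndependent_of_mul_eq_zero hf ha hu hu0 hxu),
      Fintype.card_fin]
    omega
  have huu := h.mul_mem hu hu
  have hw0 : u * u ≠ 0 := by
    intro hw0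
    obtain ⟨c, d, hcd⟩ := hf.exists_eq (z * u) (by simpa using h.mul_mem hz hu)
    have hu' : u = d • (x' * u) := by
      have h1 := hn.mul_mul_add u u z
      rw [hw0, zero_mul, zero_add, hcd, add_mul, smul_mul_assoc, smul_mul_assoc, hxu, smul_zero,
        zero_add, huz, one_smul] at h1
      exact h1.symm
    have h3 := hf.mul_mul_mul_eq (h.polar_eq_zero hn hf.mem hu (by rwa [zero_add]))
      (h.polar_eq_zero hn hf.mem' hu (by rwa [zero_add])) hxu
    have hd : u = d ^ 3 • (x' * (x' * (x' * u))) := by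
      calc u = d • (x' * u) := hu'
        _ = d • (x' * (d • (x' * u))) := congrArg (fun t => d • (x' * t)) hu'
        _ = d • (x' * (d • (x' * (d • (x' * u))))) :=
          congrArg (fun t => d • (x' * (d • (x' * t)))) hu'
        _ = _ := by
          simp only [mul_smul_comm, smul_smul]
          congr 1
          ring
    rw [h3, smul_smul] at hd
    have h4 : (d ^ 3 * α⁻¹ - 1) • u = 0 := by rw [sub_smul, one_smul, ← hd, sub_self]
    have h5 := (smul_eq_zero.1 h4).resolve_right hu0
    have hα := hf.ne_zero
    refine hf.not_cube d ?_
    field_simp at h5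
    linear_combination h5
  have hdeg : a + a = -a := by
    by_contra hne
    refine hw0 ?_
    have hm : a + a ∉ ({0, a, -a} : Finset G) := by
      simp only [Finset.mem_insert, Finset.mem_singleton, not_or]
      exact ⟨fun h' => haa (eq_neg_of_add_eq_zero_right h'), by simpa using ha, hne⟩
    have e4 := h.sum_finrank_le (insert (a + a) {0, a, -a})
    rw [Finset.sum_insert hm, Finset.sum_insert hm0, Finset.sum_pair haa] at e4
    have hbot : 𝒮 (a + a) = ⊥ := Submodule.finrank_eq_zero.1 (by omega)
    rwa [hbot, Submodule.mem_bot] at huu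
  have hx'u : x' * u ∈ 𝒮 a := by simpa using h.mul_mem hf.mem' hu
  have hp1 : polar n (u * u) (x' * u) = 0 := by
    rw [QuadraticMap.polar_comm, hn.polar_mul, hn.mul_mul_right, hnorm hu, zero_smul,
      QuadraticMap.polar_zero_right]
  have hp2 : polar n (u * u) (x' * (x' * u)) = 0 := by
    rw [QuadraticMap.polar_comm, hn.polar_mul, hn.mul_mul_eq' (x' * u), horth hx'u hu,
      hn.mul_mul_right, hnorm hu, zero_smul, zero_smul, mul_zero, sub_zero,
      QuadraticMap.polar_zero_right]
  refine hw0 (h.eq_zero_of_polar hn (hdeg ▸ huu) fun y hy => ?_)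
  rw [neg_neg, ← hspan, Submodule.mem_span_range_iff_exists_fun] at hy
  obtain ⟨c, rfl⟩ := hy
  simp only [Fin.sum_univ_three, Matrix.cons_val_zero, Matrix.cons_val_one, Matrix.cons_val,
    QuadraticMap.polar_add_right, QuadraticMap.polar_smul_right, hp1, hp2,
    QuadraticMap.polar_comm n (u * u) u, hg, smul_zero, add_zero]

end ZeroFrame

lemma _root_.OkuboGradings.OkuboAlgebra.standardGrading₁_eq_span (α β : k) (i : ZMod 3) :
    OkuboAlgebra.standardGrading₁ α β i =
      Submodule.span k {f | ∃ r, (OkuboAlgebra.idx r).2 = i ∧ f = OkuboAlgebra.x α β r} := by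
  rw [OkuboAlgebra.standardGrading₁]
  simp only [OkuboAlgebra.standardGrading₂]
  rw [← Submodule.span_iUnion]
  congr 1
  ext f
  simp only [Set.mem_iUnion, Set.mem_ofPred_eq]
  constructor
  · rintro ⟨j, r, hr, rfl⟩
    exact ⟨r, by rw [hr], rfl⟩
  · rintro ⟨r, hr, rfl⟩
    exact ⟨(OkuboAlgebra.idx r).1, r, by rw [← hr], rfl⟩

/-- A grading for which `S_0` is a plane without nonzero idempotents is the standard
`ℤ₃`-grading. -/
theorem standardZ3Case (h : IsGroupGrading 𝒮) (hn : IsSymmComp n)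
    (hdim : Module.finrank k S = 8) (h0 : 𝒮 0 ≠ ⊤) (h2 : Module.finrank k (𝒮 0) = 2)
    (hid : ∀ e ∈ 𝒮 0, e * e = e → e = 0) : StandardZ3Case n h := by
  have h0' : 𝒮 0 ≠ ⊥ := fun h' => by
    rw [h', finrank_bot] at h2
    omega
  obtain ⟨a, ha, m, hm, hm0⟩ := h.exists_ne_zero h0
  obtain ⟨z, hz, hz0, hnz⟩ := h.exists_isotropic hn h0' hid ha hm hm0
  obtain ⟨x, x', α, hf, u, hu, hu0, hxu⟩ := h.exists_mul_eq_zero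
    (hn.isZeroFrame h.zero_mul_mem (h.zero_nondegenerate hn) h2 hid hz hz0 hnz) ha hm hm0
  have hg := h.polar_sq_ne_zero_of_mul_eq_zero hf hdim h2 hid ha hu hu0 hxu
  have hdeg : a + (a + a) = 0 := by
    by_contra hne
    exact hg (h.polar_eq_zero hn hu (h.mul_mem hu hu) hne)
  obtain ⟨f, hfa⟩ := exists_zmod_hom (a := a) (by rw [add_assoc, hdeg])
  have hxx : polar n x (x * x) = -α := by
    rw [hf.sq_x, QuadraticMap.polar_smul_right, hf.polar_eq, smul_eq_mul, mul_one]
  have hframe := hn.isOkuboFrame (β := -polar n u (u * u)) hf.ne_zero (neg_ne_zero.2 hg) hf.norm_x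
    (h.norm_eq_zero_of_forall_idem hn hid ha hu) hxx (neg_neg _).symm
    (h.polar_eq_zero hn hf.mem hu (by rwa [zero_add])) hxu
  obtain ⟨hsurj, φ, hiso, hφ, hmap⟩ := h.map_eq_of_frame hframe hdim
    (f.comp (AddMonoidHom.snd (ZMod 3) (ZMod 3))) (by simpa using hf.mem) (by simpa [hfa] using hu)
  generalize -polar n u (u * u) = β at *
  have hsurj' : Function.Surjective f := fun g =>
    let ⟨p, hp⟩ := hsurj g
    ⟨p.2, hp⟩
  have hinj : Function.Injective f := by
    rw [injective_iff_map_eq_zero]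
    intro i hi
    have h2a : a + a ≠ 0 := fun h' => ha (by rwa [h', add_zero] at hdeg)
    have f2 : f 2 = a + a := by rw [← hfa, ← map_add]; rfl
    fin_cases i
    · rfl
    · exact absurd (hfa.symm.trans hi) ha
    · exact absurd (f2.symm.trans hi) h2a
  let ψ := (AddEquiv.ofBijective f ⟨hinj, hsurj'⟩).symm
  have hψ : ∀ p g, f p = g ↔ p = ψ g := fun p g =>
    (AddEquiv.eq_symm_apply (AddEquiv.ofBijective f ⟨hinj, hsurj'⟩)).symm
  have hstd : ∀ g, (𝒮 g).map (φ : S →ₗ[k] OkuboAlgebra α β) =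
      OkuboAlgebra.standardGrading₁ α β (ψ g) := fun g => by
    rw [hmap, OkuboAlgebra.standardGrading₁_eq_span]
    simp only [AddMonoidHom.comp_apply, AddMonoidHom.coe_snd, hψ]
  refine ⟨h2, hid, ψ, α, β, φ, hf.ne_zero, hframe.right_ne_zero, hiso, hstd, le_antisymm ?_ ?_⟩
  · rw [hmap, Submodule.span_le]
    rintro _ ⟨r, hr, rfl⟩
    have hx0 : OkuboAlgebra.x α β 0 ∈ NonUnitalAlgebra.adjoin k {OkuboAlgebra.x α β 0} :=
      NonUnitalAlgebra.subset_adjoin k (Set.mem_singleton _)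
    have hx1 : OkuboAlgebra.x α β 1 =
        -α⁻¹ • (OkuboAlgebra.x α β 0 * OkuboAlgebra.x α β 0) := by
      rw [← hφ 0, ← hφ 1, ← hiso.map_mul, ← map_smul]
      rfl
    have hr' : (OkuboAlgebra.idx r).2 = 0 := (injective_iff_map_eq_zero f).1 hinj _ hr
    have : r = 0 ∨ r = 1 := by
      clear hr
      revert r
      decide
    rcases this with rfl | rfl
    · exact hx0
    · rw [hx1]
      have hxx : OkuboAlgebra.x α β 0 * OkuboAlgebra.x α β 0 ∈
          NonUnitalAlgebra.adjoin k {OkuboAlgebra.x α β 0} := MulMemClass.mul_mem hx0 hx0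
      exact Submodule.smul_mem _ _ hxx
  · let T : NonUnitalSubalgebra k (OkuboAlgebra α β) :=
      { (𝒮 0).map (φ : S →ₗ[k] OkuboAlgebra α β) with
        mul_mem' := by
          rintro _ _ ⟨y, hy, rfl⟩ ⟨z, hz, rfl⟩
          exact ⟨y * z, h.zero_mul_mem y hy z hz, hiso.map_mul y z⟩ }
    have hT : NonUnitalAlgebra.adjoin k {OkuboAlgebra.x α β 0} ≤ T := by
      rw [NonUnitalAlgebra.adjoin_le_iff, Set.singleton_subset_iff]
      change OkuboAlgebra.x α β 0 ∈ (𝒮 0).map (φ : S →ₗ[k] OkuboAlgebra α β)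
      rw [hmap]
      exact Submodule.subset_span ⟨0, map_zero f, rfl⟩
    exact hT

end IsGroupGrading

end OkuboGradings

theorem mainTheorem2 {k : Type u} [Field k] {S : Type v} [NonUnitalNonAssocRing S] [Module k S]
    [IsScalarTower k S S] [SMulCommClass k S S] (n : QuadraticForm k S) (hS : IsOkubo n)
    {G : Type w} [AddGroup G] [DecidableEq G] (𝒮 : G → Submodule k S) (h𝒮 : IsGroupGrading 𝒮)
    (hnontrivial : 𝒮 0 ≠ ⊤) :
    (ParaHurwitzCase n h𝒮 ∨ StandardZ3Case n h𝒮 ∨ StandardZ3SquaredCase n h𝒮) ∧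
      ¬ (ParaHurwitzCase n h𝒮 ∧ StandardZ3Case n h𝒮) ∧
      ¬ (ParaHurwitzCase n h𝒮 ∧ StandardZ3SquaredCase n h𝒮) ∧
      ¬ (StandardZ3Case n h𝒮 ∧ StandardZ3SquaredCase n h𝒮) := by
  have hn := hS.isSymmComp
  have hdim := hS.finrank_eq
  refine ⟨?_, ?_, fun ⟨h1, h3⟩ => h1.1 h3.1, ?_⟩
  · by_cases h0 : 𝒮 0 = ⊥
    · exact Or.inr (Or.inr (h𝒮.standardZ3SquaredCase hn hdim h0 hnontrivial))
    · have hpara : (∃ e ∈ 𝒮 0, e ≠ 0 ∧ e * e = e ∧ ∀ x ∈ 𝒮 0, e * x = x * e) →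
          ParaHurwitzCase n h𝒮 := by
        rintro ⟨e, he, he0, hee, hcomm⟩
        refine ⟨h0, IsParaUnit.isParaHurwitz (e := (⟨e, he⟩ : h𝒮.zero)) ⟨?_, fun h' =>
          he0 (congrArg Subtype.val h'), Subtype.ext hee, fun x => Subtype.ext (hcomm x x.2)⟩⟩
        exact ⟨fun x y => Subtype.ext (hn.mul_mul_left x y),
          fun x y => Subtype.ext (hn.mul_mul_right x y), fun x y => hn.norm_mul x y,
          fun x y z => hn.polar_mul x y z, fun x hx => Subtype.ext
            (h𝒮.zero_nondegenerate hn x x.2 fun y hy => hx ⟨y, hy⟩)⟩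
      rcases hn.exists_central_idempotent_or_plane hdim h𝒮.zero_mul_mem
        (h𝒮.zero_nondegenerate hn) h0 hnontrivial with hc | ⟨h2, hcomm⟩
      · exact Or.inl (hpara hc)
      · by_cases hid : ∀ e ∈ 𝒮 0, e * e = e → e = 0
        · exact Or.inr (Or.inl (h𝒮.standardZ3Case hn hdim hnontrivial h2 hid))
        · push Not at hid
          obtain ⟨e, he, hee, he0⟩ := hid
          exact Or.inl (hpara ⟨e, he, he0, hee, hcomm e he⟩)
  · rintro ⟨⟨-, h1⟩, -, h2, -⟩
    obtain ⟨e, he0, hee⟩ := h1.exists_isIdempotent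
    exact he0 (Subtype.ext (h2 e e.2 (congrArg Subtype.val hee)))
  · rintro ⟨⟨h1, -⟩, h2, -⟩
    have h1' : Module.finrank k (𝒮 0) = 2 := h1
    rw [h2, finrank_bot] at h1'
    omega
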